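/- Let $d\ge 1$. A measure $\nu$ on $\mathbb R^d$ is a Lévy measure if $\nu(\{0\})=0$ and $\int_{\mathbb R^d}\min(\|x\|^2,1)\,d\nu(x)<\infty$. A random vector $\xi$ in $\mathbb R^d$ is infinitely divisible with Lévy triplet $(A,\nu,b)$, where $A=(a_{ij})$ is a symmetric non-negative definite $d\times d$ matrix, $\nu$ is a Lévy measure on $\mathbb R^d$ and $b\in\mathbb R^d$, if for all $u\in\mathbb R^d$ $$\mathbf E e^{\mathrm i\langle u,\xi\rangle}=\exp\Bigl\{\mathrm i\langle b,u\rangle-\tfrac12\langle u,Au\rangle+\int_{\mathbb R^d}\bigl(e^{\mathrm i\langle u,x\rangle}-1-\mathrm i\langle u,x\rangle\mathbf 1_{\|x\|\le1}\bigr)\,d\nu(x)\Bigr\}.$$ Two integrable random vectors $\eta,\eta^*$ in $\mathbb R^d$ are zonoid equivalent if $\mathbf E|\langle u,\eta\rangle|=\mathbf E|\langle u,\eta^*\rangle|$ for all $u\in\mathbb R^d$. Write $e^{\xi}=(e^{\xi_1},\dots,e^{\xi_d})$, and for $d\ge2$ let $U$ be the $(d-1)\times d$ matrix with $Ux=(x_1-x_d,\dots,x_{d-1}-x_d)$.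 **Theorem.** Let $\xi$ and $\xi^*$ be infinitely divisible random vectors in $\mathbb R^d$ with Lévy triplets $(A,\nu,b)$ and $(A^*,\nu^*,b^*)$ such that $e^{\xi}$ and $e^{\xi^*}$ are integrable. If $d\ge2$, then $e^{\xi}$ and $e^{\xi^*}$ are zonoid equivalent if and only if the following three conditions hold: (a) $\gamma_{ij}=\gamma^*_{ij}$ for all $i,j\in\{1,\dots,d\}$, where $\gamma_{ij}=a_{ii}+a_{jj}-2a_{ij}$ and $\gamma^*_{ij}=a^*_{ii}+a^*_{jj}-2a^*_{ij}$; (b) the images under $U$ of the measures $d\hat\nu(x)=e^{x_d}\,d\nu(x)$ and $d\hat\nu^*(x)=e^{x_d}\,d\nu^*(x)$, restricted to $\mathbb R^{d-1}\setminus\{0\}$, coincide; (c) $\mathbf E e^{\xi_i}=\mathbf E e^{\xi^*_i}$ for all $i=1,\dots,d$. If $d=1$, then $e^{\xi}$ and $e^{\xi^*}$ are zonoid equivalent if and only if (c) holds. Moreover, for every $d\ge1$ and each $i$, the function $x\mapsto e^{x_i}-1-x_i\mathbf 1_{\|x\|\le1}$ is integrable with respect to $\nu$ and $\nu^*$, and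 $\mathbf E e^{\xi_i}=\mathbf E e^{\xi^*_i}$ is equivalent to $$b_i+\tfrac12a_{ii}+\int_{\mathbb R^d}\bigl(e^{x_i}-1-x_i\mathbf 1_{\|x\|\le1}\bigr)\,d\nu(x)=b^*_i+\tfrac12a^*_{ii}+\int_{\mathbb R^d}\bigl(e^{x_i}-1-x_i\mathbf 1_{\|x\|\le1}\bigr)\,d\nu^*(x).$$ -/

import Mathlib

open MeasureTheory
open scoped Matrix

noncomputable section

/-- Two integrable random vectors (possibly on different probability spaces) are zonoid
equivalent if `E|⟨u, η⟩| = E|⟨u, η'⟩|` for all `u`, that is, if the support functions of their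
centred zonoids coincide. -/
structure ZonoidEquivalent {d : ℕ} {Ω Ω' : Type*} [MeasurableSpace Ω] [MeasurableSpace Ω']
    (η : Ω → EuclideanSpace ℝ (Fin d)) (P : Measure Ω)
    (η' : Ω' → EuclideanSpace ℝ (Fin d)) (P' : Measure Ω') : Prop where
  integrable_left : Integrable η P
  integrable_right : Integrable η' P'
  integral_abs_inner_eq : ∀ u : EuclideanSpace ℝ (Fin d),
    ∫ ω, |inner ℝ u (η ω)| ∂P = ∫ ω, |inner ℝ u (η' ω)| ∂P'

/-- The coordinatewise exponential of a vector. -/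
def expVec {d : ℕ} (x : EuclideanSpace ℝ (Fin d)) : EuclideanSpace ℝ (Fin d) :=
  WithLp.toLp 2 fun i => Real.exp (x i)

/-- Lévy measures: `ν {0} = 0` and `∫ min(‖x‖², 1) dν < ∞`. -/
structure IsLevyMeasure {d : ℕ} (ν : Measure (EuclideanSpace ℝ (Fin d))) : Prop where
  measure_zero : ν {0} = 0
  lintegral_lt_top : ∫⁻ x, ENNReal.ofReal (min (‖x‖ ^ 2) 1) ∂ν < ⊤

/-- The truncation function `1_{‖x‖ ≤ 1}`. -/
def levyTrunc {d : ℕ} (x : EuclideanSpace ℝ (Fin d)) : ℝ :=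
  (Metric.closedBall (0 : EuclideanSpace ℝ (Fin d)) 1).indicator (fun _ => (1 : ℝ)) x

/-- The distribution `μ` is infinitely divisible with Lévy triplet `(A, ν, b)`: `A` is symmetric
and non-negative definite, `ν` is a Lévy measure, and the characteristic function of `μ` is given
by the Lévy–Khintchine formula with the truncation `1_{‖x‖ ≤ 1}`. -/
structure HasLevyTriplet {d : ℕ} (μ : Measure (EuclideanSpace ℝ (Fin d)))
    (A : Matrix (Fin d) (Fin d) ℝ) (ν : Measure (EuclideanSpace ℝ (Fin d)))
    (b : EuclideanSpace ℝ (Fin d)) : Prop where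
  posSemidef : A.PosSemidef
  isLevyMeasure : IsLevyMeasure ν
  charFun_eq : ∀ u : EuclideanSpace ℝ (Fin d),
    charFun μ u = Complex.exp
      (Complex.I * (inner ℝ b u : ℝ) - (1 / 2 : ℂ) * (inner ℝ u (A.toEuclideanLin u) : ℝ)
        + ∫ x, (Complex.exp (Complex.I * (inner ℝ u x : ℝ)) - 1
            - Complex.I * (inner ℝ u x : ℝ) * (levyTrunc x : ℝ)) ∂ν)

/-- The variogram `γ i j = a i i + a j j - 2 a i j` of a matrix. -/
def variogram {d : ℕ} (A : Matrix (Fin d) (Fin d) ℝ) (i j : Fin d) : ℝ :=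
  A i i + A j j - 2 * A i j

/-- The `m × (m + 1)` matrix `U` (so `d = m + 1`): the identity matrix followed by a last column
with all entries `-1`. -/
def matrixU (m : ℕ) : Matrix (Fin m) (Fin (m + 1)) ℝ :=
  Matrix.of fun i => Fin.snoc (α := fun _ => ℝ) (fun j : Fin m => if i = j then 1 else 0) (-1)

/-- The measure `e^{x_d} dν(x)`, where `x_d` is the last coordinate and `d = m + 1`. -/
def tiltLast {m : ℕ} (ν : Measure (EuclideanSpace ℝ (Fin (m + 1)))) :
    Measure (EuclideanSpace ℝ (Fin (m + 1))) :=
  ν.withDensity fun x => ENNReal.ofReal (Real.exp (x (Fin.last m)))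

/-- The image under `U` of the measure `e^{x_d} dν(x)`, restricted to `ℝ^{d-1} ∖ {0}`. -/
def tiltedImage {m : ℕ} (ν : Measure (EuclideanSpace ℝ (Fin (m + 1)))) :
    Measure (EuclideanSpace ℝ (Fin m)) :=
  ((tiltLast ν).map fun x => (matrixU m).toEuclideanLin x).restrict {0}ᶜ

/-- The function `e^{x_i} - 1 - x_i 1_{‖x‖ ≤ 1}`. -/
def expCompensated {d : ℕ} (i : Fin d) (x : EuclideanSpace ℝ (Fin d)) : ℝ :=
  Real.exp (x i) - 1 - x i * levyTrunc x

/-- `b_i + a_ii / 2 + ∫ (e^{x_i} - 1 - x_i 1_{‖x‖ ≤ 1}) dν(x)`. -/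
def levyExponent {d : ℕ} (A : Matrix (Fin d) (Fin d) ℝ)
    (ν : Measure (EuclideanSpace ℝ (Fin d))) (b : EuclideanSpace ℝ (Fin d)) (i : Fin d) : ℝ :=
  b i + 1 / 2 * A i i + ∫ x, expCompensated i x ∂ν

end

noncomputable section

open Complex Filter Topology HadamardThreeLines
open scoped ENNReal Nat NNReal

/-! Write d = m + 1. Factoring out the last coordinate gives ⟨(u, c), e^x⟩ = e^{x_d} (c + ⟨u,
e^{Ux}⟩), so zonoid equivalence compares the integrals of |c + ⟨u, e^y⟩| under the images by U of
the measures e^{x_d} dμ, where μ is the law of ξ. Such integrals determine a finite measure: on the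
line one differentiates ∫|x - c| in c, and Cramér–Wold does the rest. Hence zonoid equivalence means
that the two tilted images coincide (`integral_abs_inner_expVec_eq_iff`).

The characteristic function of the tilted image at v is E exp(ξ_d + i⟨Uᵀv, ξ⟩) = exp ψ(e_d + iUᵀv),
with ψ the Lévy–Khintchine exponent continued to complex arguments
(`HasLevyTriplet.integral_exp_eq`). The continuation rests on two facts: an exponential moment of ξ
passes to the large jumps of ν, by comparison with compound Poisson laws
(`HasLevyTriplet.integrable_levyDom`), and a bounded holomorphic function on a strip is determined
by one boundary line.

If the images coincide, the exponents agree, being continuous logarithms of the same function with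
the same value at v = 0. Second differences in v remove the drift and leave the Fourier transform of
a finite measure: an atom ½⟨Uᵀk, AUᵀk⟩ at 0 plus the tilted jump measure with density 1 - cos⟨k, y⟩.
This separates the Gaussian part from the jumps
(`quadratic_eq_and_measure_eq_of_second_difference_eq`). Conversely, the coordinates of Uᵀv sum to
zero, so the exponent can be written through the variogram, the tilted jump measure and the
logarithms of the means alone (`levyPsi_adjointU_eq`). -/

/-- The integrand of the Lévy–Khintchine formula at the complex vector `z • a + i w`. -/
def levyKernel {d : ℕ} (z : ℂ) (a w x : EuclideanSpace ℝ (Fin d)) : ℂ :=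
  cexp (z * (inner ℝ a x : ℝ) + I * (inner ℝ w x : ℝ)) - 1
    - (z * (inner ℝ a x : ℝ) + I * (inner ℝ w x : ℝ)) * (levyTrunc x : ℝ)

/-- The Lévy–Khintchine exponent at the complex vector `z • a + i w`. -/
def levyPsi {d : ℕ} (A : Matrix (Fin d) (Fin d) ℝ) (ν : Measure (EuclideanSpace ℝ (Fin d)))
    (b : EuclideanSpace ℝ (Fin d)) (z : ℂ) (a w : EuclideanSpace ℝ (Fin d)) : ℂ :=
  z * (inner ℝ b a : ℝ) + I * (inner ℝ b w : ℝ)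
    + 1 / 2 * (z ^ 2 * (inner ℝ a (A.toEuclideanLin a) : ℝ)
      + 2 * I * z * (inner ℝ a (A.toEuclideanLin w) : ℝ)
      - (inner ℝ w (A.toEuclideanLin w) : ℝ))
    + ∫ x, levyKernel z a w x ∂ν

/-- A function that dominates the Lévy–Khintchine integrand on the strip `0 ≤ re z ≤ 1`. -/
def levyDom {d : ℕ} (a x : EuclideanSpace ℝ (Fin d)) : ℝ :=
  min (‖x‖ ^ 2) 1 + {x | 1 < ‖x‖}.indicator (fun x => Real.exp (inner ℝ a x)) x

/-! ### Domination of the Lévy–Khintchine integrand -/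

section LevyBasics

variable {d : ℕ} {ν : Measure (EuclideanSpace ℝ (Fin d))}

lemma levyTrunc_of_norm_le {x : EuclideanSpace ℝ (Fin d)} (h : ‖x‖ ≤ 1) : levyTrunc x = 1 := by
  simp [levyTrunc, h]

lemma levyTrunc_of_lt_norm {x : EuclideanSpace ℝ (Fin d)} (h : 1 < ‖x‖) : levyTrunc x = 0 := by
  simp [levyTrunc, h]

@[fun_prop]
lemma measurable_levyTrunc : Measurable (levyTrunc (d := d)) :=
  measurable_const.indicator Metric.isClosed_closedBall.measurableSet

lemma measurableSet_lt_norm (r : ℝ) : MeasurableSet {x : EuclideanSpace ℝ (Fin d) | r < ‖x‖} :=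
  measurableSet_lt measurable_const measurable_norm

@[fun_prop]
lemma measurable_levyKernel (z : ℂ) (a w : EuclideanSpace ℝ (Fin d)) :
    Measurable (levyKernel z a w) := by
  unfold levyKernel; fun_prop

lemma IsLevyMeasure.integrable_min (hν : IsLevyMeasure ν) :
    Integrable (fun x => min (‖x‖ ^ 2) 1) ν := by
  refine ⟨by fun_prop, ?_⟩
  rw [hasFiniteIntegral_iff_ofReal (ae_of_all _ fun x => by positivity)]
  exact hν.lintegral_lt_top

lemma IsLevyMeasure.measure_lt_norm_lt_top (hν : IsLevyMeasure ν) {r : ℝ} (hr : 0 < r) :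
    ν {x | r < ‖x‖} < ⊤ := by
  have h0 : (0 : ℝ) < min (r ^ 2) 1 := by positivity
  refine (measure_mono fun x (hx : r < ‖x‖) => ?_).trans_lt
    (hν.integrable_min.measure_norm_ge_lt_top h0)
  have : r ^ 2 ≤ ‖x‖ ^ 2 := by gcongr
  simp only [Set.mem_ofPred_eq, Real.norm_eq_abs]
  exact (min_le_min_right 1 this).trans (le_abs_self _)

lemma levyDom_of_norm_le {a x : EuclideanSpace ℝ (Fin d)} (h : ‖x‖ ≤ 1) :
    levyDom a x = ‖x‖ ^ 2 := by
  have : ‖x‖ ^ 2 ≤ 1 := pow_le_one₀ (norm_nonneg _) h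
  simp [levyDom, h.not_gt, this]

lemma levyDom_of_lt_norm {a x : EuclideanSpace ℝ (Fin d)} (h : 1 < ‖x‖) :
    levyDom a x = 1 + Real.exp (inner ℝ a x) := by
  have : 1 ≤ ‖x‖ ^ 2 := one_le_pow₀ h.le
  simp [levyDom, h, this]

lemma norm_exp_sub_one_sub_le (ζ : ℂ) : ‖cexp ζ - 1 - ζ‖ ≤ ‖ζ‖ ^ 2 * Real.exp ‖ζ‖ := by
  have h := Complex.norm_exp_sub_sum_le_norm_mul_exp ζ 2
  simpa [Finset.sum_range_succ, sub_sub] using h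

lemma norm_exp_le_one_add_exp {z : ℂ} (hz : z.re ∈ Set.Icc (0 : ℝ) 1) (y t : ℝ) :
    ‖cexp (z * y + I * t)‖ ≤ 1 + Real.exp y := by
  rw [Complex.norm_exp]
  simp only [add_re, mul_re, ofReal_re, ofReal_im, mul_zero, sub_zero, I_re, zero_mul, I_im,
    add_zero]
  rcases le_total y 0 with h | h
  · have : Real.exp (z.re * y) ≤ 1 := Real.exp_le_one_iff.2 (by nlinarith [hz.1])
    linarith [Real.exp_pos y]
  · have : Real.exp (z.re * y) ≤ Real.exp y := Real.exp_le_exp.2 (by nlinarith [hz.2])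
    linarith

/-- In the unit ball this is the second-order Taylor bound; outside it, the exponential is at most 1
+ e^{⟨a, x⟩} because re z lies in [0, 1]. The free `R` makes the bound uniform over bounded z and w,
as needed for holomorphy in z and continuity in w of the integral. -/
lemma norm_levyKernel_le {z : ℂ} (hz : z.re ∈ Set.Icc (0 : ℝ) 1)
    {a w : EuclideanSpace ℝ (Fin d)} {R : ℝ} (hR : ‖z‖ * ‖a‖ + ‖w‖ ≤ R)
    (x : EuclideanSpace ℝ (Fin d)) :
    ‖levyKernel z a w x‖ ≤ (R ^ 2 * Real.exp R + 2) * levyDom a x := by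
  have hR0 : 0 ≤ R := le_trans (by positivity) hR
  rcases le_or_gt ‖x‖ 1 with hx | hx
  · rw [levyDom_of_norm_le hx, levyKernel, levyTrunc_of_norm_le hx]
    simp only [ofReal_one, mul_one]
    set ζ : ℂ := z * (inner ℝ a x : ℝ) + I * (inner ℝ w x : ℝ)
    have hζ : ‖ζ‖ ≤ R * ‖x‖ := by
      calc ‖ζ‖ ≤ ‖z‖ * ‖inner ℝ a x‖ + ‖inner ℝ w x‖ := by
            refine (norm_add_le _ _).trans ?_
            simp
        _ ≤ ‖z‖ * (‖a‖ * ‖x‖) + ‖w‖ * ‖x‖ := by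
            gcongr <;> exact norm_inner_le_norm _ _
        _ = (‖z‖ * ‖a‖ + ‖w‖) * ‖x‖ := by ring
        _ ≤ R * ‖x‖ := by gcongr
    have hζ' : ‖ζ‖ ≤ R := hζ.trans (mul_le_of_le_one_right hR0 hx)
    calc ‖cexp ζ - 1 - ζ‖ ≤ ‖ζ‖ ^ 2 * Real.exp ‖ζ‖ := norm_exp_sub_one_sub_le ζ
      _ ≤ (R * ‖x‖) ^ 2 * Real.exp R := by gcongr
      _ ≤ (R ^ 2 * Real.exp R + 2) * ‖x‖ ^ 2 := by
        rw [mul_pow]; nlinarith [sq_nonneg ‖x‖]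
  · rw [levyDom_of_lt_norm hx, levyKernel, levyTrunc_of_lt_norm hx]
    simp only [ofReal_zero, mul_zero, sub_zero]
    have h1 : ‖cexp (z * (inner ℝ a x : ℝ) + I * (inner ℝ w x : ℝ))‖
        ≤ 1 + Real.exp (inner ℝ a x) := norm_exp_le_one_add_exp hz _ _
    have h2 : 0 ≤ R ^ 2 * Real.exp R := by positivity
    calc _ ≤ ‖cexp (z * (inner ℝ a x : ℝ) + I * (inner ℝ w x : ℝ))‖ + ‖(1 : ℂ)‖ := norm_sub_le _ _
      _ ≤ (1 + Real.exp (inner ℝ a x)) + 1 := by simpa using h1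
      _ ≤ _ := by nlinarith [Real.exp_pos (inner ℝ a x)]

lemma integrable_levyKernel {a : EuclideanSpace ℝ (Fin d)} (hd : Integrable (levyDom a) ν)
    {z : ℂ} (hz : z.re ∈ Set.Icc (0 : ℝ) 1) (w : EuclideanSpace ℝ (Fin d)) :
    Integrable (levyKernel z a w) ν :=
  (hd.const_mul _).mono' (measurable_levyKernel z a w).aestronglyMeasurable
    (ae_of_all _ fun x => norm_levyKernel_le hz le_rfl x)

lemma IsLevyMeasure.integrable_levyDom_zero (hν : IsLevyMeasure ν) :
    Integrable (levyDom (0 : EuclideanSpace ℝ (Fin d))) ν := by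
  refine hν.integrable_min.add ?_
  rw [integrable_indicator_iff (measurableSet_lt_norm 1)]
  simp only [inner_zero_left, Real.exp_zero]
  exact integrableOn_const (hν.measure_lt_norm_lt_top one_pos).ne

lemma levyKernel_zero_smul (a w x : EuclideanSpace ℝ (Fin d)) (θ : ℝ) :
    levyKernel (θ * I) a w x = levyKernel 0 0 (θ • a + w) x := by
  unfold levyKernel
  simp only [inner_add_left, inner_smul_left, inner_zero_left]
  push_cast
  simp only [conj_trivial]
  ring_nf

end LevyBasics

/-! ### Compound Poisson laws and exponential moments -/

/-- Convolution powers of a measure on the real line. -/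
def convPow (ν : Measure ℝ) : ℕ → Measure ℝ
  | 0 => Measure.dirac 0
  | k + 1 => convPow ν k ∗ ν

/-- The compound Poisson distribution with jump measure `ν`. -/
def compoundPoisson (ν : Measure ℝ) : Measure ℝ :=
  Measure.sum fun k : ℕ => ENNReal.ofReal (Real.exp (-ν.real Set.univ) / k !) • convPow ν k

section CompoundPoisson

variable (ν : Measure ℝ) [IsFiniteMeasure ν]

instance isFiniteMeasure_convPow (k : ℕ) : IsFiniteMeasure (convPow ν k) := by
  induction k with
  | zero => exact inferInstanceAs (IsFiniteMeasure (Measure.dirac 0))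
  | succ k ih => exact inferInstanceAs (IsFiniteMeasure (convPow ν k ∗ ν))

lemma charFun_convPow (k : ℕ) (t : ℝ) : charFun (convPow ν k) t = charFun ν t ^ k := by
  induction k with
  | zero => simp [convPow, charFun_dirac]
  | succ k ih => rw [convPow, charFun_conv, ih, pow_succ]

lemma convPow_univ (k : ℕ) :
    convPow ν k Set.univ = ENNReal.ofReal (ν.real Set.univ ^ k) := by
  have h := charFun_convPow ν k 0
  rw [charFun_zero, charFun_zero] at h
  have h' : (convPow ν k).real Set.univ = ν.real Set.univ ^ k := by exact_mod_cast h
  rw [← h', ofReal_measureReal]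

instance isProbabilityMeasure_compoundPoisson : IsProbabilityMeasure (compoundPoisson ν) := by
  constructor
  rw [compoundPoisson, Measure.sum_apply _ MeasurableSet.univ]
  simp only [Measure.smul_apply, smul_eq_mul, convPow_univ]
  have h0 (k : ℕ) : 0 ≤ Real.exp (-ν.real Set.univ) / k ! := by positivity
  have hs : HasSum (fun k : ℕ => Real.exp (-ν.real Set.univ) / k ! * ν.real Set.univ ^ k) 1 := by
    have := (NormedSpace.expSeries_div_hasSum_exp (𝔸 := ℝ) (ν.real Set.univ)).mul_left
      (Real.exp (-ν.real Set.univ))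
    rw [← Real.exp_eq_exp_ℝ, ← Real.exp_add, neg_add_cancel, Real.exp_zero] at this
    have e : (fun k : ℕ => Real.exp (-ν.real Set.univ) / k ! * ν.real Set.univ ^ k)
        = fun k : ℕ => Real.exp (-ν.real Set.univ) * (ν.real Set.univ ^ k / k !) :=
      funext fun k => by ring
    rw [e]
    exact this
  simp only [← ENNReal.ofReal_mul (h0 _)]
  rw [← ENNReal.ofReal_tsum_of_nonneg (fun k => mul_nonneg (h0 k) (by positivity)) hs.summable,
    hs.tsum_eq, ENNReal.ofReal_one]

lemma charFun_compoundPoisson (t : ℝ) :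
    charFun (compoundPoisson ν) t = cexp (charFun ν t - ν.real Set.univ) := by
  have hint : Integrable (fun x : ℝ => cexp (inner ℝ x t * I)) (compoundPoisson ν) := by
    refine (integrable_const (1 : ℝ)).mono' (by fun_prop) (ae_of_all _ fun x => ?_)
    rw [Complex.norm_exp_ofReal_mul_I]
  have h := hasSum_integral_measure hint
  simp only [integral_smul_measure] at h
  refine h.unique ?_
  simp only [← charFun_apply, charFun_convPow]
  have := (NormedSpace.expSeries_div_hasSum_exp (𝔸 := ℂ) (charFun ν t)).mul_left
    (cexp (-ν.real Set.univ))
  rw [← Complex.exp_eq_exp_ℂ, ← Complex.exp_add] at this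
  have e (k : ℕ) : (ENNReal.ofReal (Real.exp (-ν.real Set.univ) / k !)).toReal • charFun ν t ^ k
      = cexp (-ν.real Set.univ) * (charFun ν t ^ k / k !) := by
    rw [ENNReal.toReal_ofReal (by positivity), Complex.real_smul]
    push_cast
    ring
  rw [sub_eq_neg_add]
  simp only [e]
  exact this

omit [IsFiniteMeasure ν] in
lemma compoundPoisson_ge_dirac :
    ENNReal.ofReal (Real.exp (-ν.real Set.univ)) • Measure.dirac 0 ≤ compoundPoisson ν := by
  refine le_trans (le_of_eq ?_) (Measure.le_sum _ 0)
  simp [convPow]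

/-- Keep only the one-jump term of the series, as `compoundPoisson_ge_dirac` keeps only the no-jump
term. -/
lemma compoundPoisson_ge :
    ENNReal.ofReal (Real.exp (-ν.real Set.univ)) • ν ≤ compoundPoisson ν := by
  refine le_trans (le_of_eq ?_) (Measure.le_sum _ 1)
  simp [convPow]

lemma charFun_sub_measureReal_univ (ν : Measure ℝ) [IsFiniteMeasure ν] (t : ℝ) :
    charFun ν t - ν.real Set.univ = ∫ x, (cexp (I * (t * x : ℝ)) - 1) ∂ν := by
  rw [integral_sub, charFun_apply_real]
  · simp only [integral_const, mul_one, real_smul]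
    congr 2 with x
    push_cast
    ring_nf
  · refine (integrable_const (1 : ℝ)).mono' (by fun_prop) (ae_of_all _ fun x => ?_)
    rw [mul_comm, Complex.norm_exp_ofReal_mul_I]
  · exact integrable_const _

variable {ν}

/-- If laws of the form `κ n * compoundPoisson ν` converge weakly to a law with an exponential
moment, then `ν` has an exponential moment. -/
lemma lintegral_exp_lt_top_of_tendsto_charFun {μ : Measure ℝ} [IsProbabilityMeasure μ]
    {κ : ℕ → Measure ℝ} [∀ n, IsProbabilityMeasure (κ n)]
    (h : ∀ t, Tendsto (fun n => charFun (κ n ∗ compoundPoisson ν) t) atTop (𝓝 (charFun μ t)))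
    (hμ : ∫⁻ x, ENNReal.ofReal (Real.exp x) ∂μ < ⊤) :
    ∫⁻ x, ENNReal.ofReal (Real.exp x) ∂ν < ⊤ := by
  set c : ℝ≥0∞ := ENNReal.ofReal (Real.exp (-ν.real Set.univ)) with hc
  have hc0 : c ≠ 0 := by simp [hc, Real.exp_pos]
  have hct : c ≠ ⊤ := ENNReal.ofReal_ne_top
  set η : ℕ → Measure ℝ := fun n => κ n ∗ compoundPoisson ν with hη
  have hprob (n : ℕ) : IsProbabilityMeasure (η n) := by rw [hη]; infer_instance
  have hlint (n : ℕ) (g : ℝ → ℝ≥0∞) (hg : Measurable g) :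
      c * ∫⁻ x, ∫⁻ y, g (x + y) ∂ν ∂κ n ≤ ∫⁻ x, g x ∂η n := by
    rw [hη, Measure.lintegral_conv hg, ← lintegral_const_mul' _ _ hct]
    refine lintegral_mono fun x => ?_
    rw [← smul_eq_mul, ← lintegral_smul_measure]
    exact lintegral_mono' (compoundPoisson_ge ν) le_rfl
  have hdir (n : ℕ) (g : ℝ → ℝ≥0∞) (hg : Measurable g) :
      c * ∫⁻ x, g x ∂κ n ≤ ∫⁻ x, g x ∂η n := by
    rw [hη, Measure.lintegral_conv hg, ← lintegral_const_mul' _ _ hct]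
    refine lintegral_mono fun x => ?_
    calc c * g x = ∫⁻ y, g (x + y) ∂(c • Measure.dirac 0) := by
          rw [lintegral_smul_measure, lintegral_dirac' _ (by fun_prop), add_zero, smul_eq_mul]
      _ ≤ _ := lintegral_mono' (compoundPoisson_ge_dirac ν) le_rfl
  -- The weakly convergent laws `η n` are tight and dominate `c • κ n` by `hdir`. A compact set
  -- missing at most `c / 2` of the mass of each `η n` misses at most half of each `κ n`.
  obtain ⟨r, hr0, hr⟩ : ∃ r : ℝ, 0 ≤ r ∧ ∀ n, 1 / 2 ≤ κ n (Set.Ici (-r)) := by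
    have htight := isTightMeasureSet_of_tendsto_charFun (μ := η)
      (f := charFun μ) (by fun_prop) h
    rw [isTightMeasureSet_iff_exists_isCompact_measure_compl_le] at htight
    obtain ⟨K, hK, hKle⟩ := htight (c / 2) (by simp [hc0])
    obtain ⟨r, hr⟩ := hK.isBounded.exists_pos_norm_le
    refine ⟨r, hr.1.le, fun n => ?_⟩
    have h1 : κ n Kᶜ ≤ 1 / 2 := by
      have h2 := (hdir n (Kᶜ.indicator 1)
        (measurable_one.indicator hK.measurableSet.compl)).trans_eq
        (lintegral_indicator_one hK.measurableSet.compl)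
      rw [lintegral_indicator_one hK.measurableSet.compl] at h2
      have h3 := h2.trans (hKle (η n) ⟨n, rfl⟩)
      rw [div_eq_mul_inv] at h3
      simpa using (ENNReal.mul_le_mul_iff_right hc0 hct).1 h3
    have h4 : κ n K ≤ κ n (Set.Ici (-r)) :=
      measure_mono fun x hx => (abs_le.1 (hr.2 x hx)).1
    refine le_trans ?_ h4
    have h5 := prob_add_prob_compl (μ := κ n) hK.measurableSet
    by_contra! hlt
    have : κ n K + κ n Kᶜ < 1 / 2 + 1 / 2 :=
      ENNReal.add_lt_add_of_lt_of_le (measure_ne_top _ _) hlt h1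
    rw [h5, ENNReal.add_halves] at this
    exact lt_irrefl _ this
  let ηP : ℕ → ProbabilityMeasure ℝ := fun n => ⟨η n, hprob n⟩
  let μP : ProbabilityMeasure ℝ := ⟨μ, inferInstance⟩
  have hweak : Tendsto ηP atTop (𝓝 μP) :=
    ProbabilityMeasure.tendsto_of_tendsto_charFun h
  rw [ProbabilityMeasure.tendsto_iff_forall_lintegral_tendsto] at hweak
  set D : ℝ≥0∞ := c * (ENNReal.ofReal (Real.exp (-r)) * (1 / 2)) with hD
  have hD0 : D ≠ 0 := by
    simp [hD, hc0, Real.exp_pos]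
  have hDt : D ≠ ⊤ := by
    rw [hD]; finiteness
  -- The truncated exponential is a bounded continuous test function, so weak convergence applies.
  -- One jump of `ν`, with weight `c`, added to a value at least `-r`, of `κ n`-probability at least
  -- 1/2, accounts for `D`, which depends neither on n nor on M.
  have hM (M : ℕ) : D * ∫⁻ y, ENNReal.ofReal (min (Real.exp y) M) ∂ν
      ≤ ∫⁻ x, ENNReal.ofReal (Real.exp x) ∂μ := by
    let f : BoundedContinuousFunction ℝ ℝ≥0 :=
      BoundedContinuousFunction.mkOfBound ⟨fun y => (min (Real.exp y) M).toNNReal, by fun_prop⟩ M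
        fun x y => by
          simp only [ContinuousMap.coe_mk, NNReal.dist_eq, Real.coe_toNNReal']
          have hx := (Real.exp_pos x).le
          have hy := (Real.exp_pos y).le
          have hM0 : (0 : ℝ) ≤ M := by positivity
          rw [max_eq_left (le_min hx hM0), max_eq_left (le_min hy hM0), abs_le]
          have := min_le_right (Real.exp x) (M : ℝ)
          have := min_le_right (Real.exp y) (M : ℝ)
          have := le_min hx hM0
          have := le_min hy hM0
          constructor <;> linarith
    have hf (x : ℝ) : (f x : ℝ≥0∞) = ENNReal.ofReal (min (Real.exp x) M) := rfl
    have hlim := hweak f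
    simp only [hf] at hlim
    change Tendsto (fun n => ∫⁻ x, ENNReal.ofReal (min (Real.exp x) M) ∂η n) atTop
      (𝓝 (∫⁻ x, ENNReal.ofReal (min (Real.exp x) M) ∂μ)) at hlim
    refine (ge_of_tendsto' hlim fun n => ?_).trans
      (lintegral_mono fun x => ENNReal.ofReal_le_ofReal (min_le_left _ _))
    refine le_trans ?_ (hlint n _ (by fun_prop))
    rw [hD, mul_assoc]
    gcongr
    calc ENNReal.ofReal (Real.exp (-r)) * (1 / 2) * ∫⁻ y, ENNReal.ofReal (min (Real.exp y) M) ∂ν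
        ≤ ENNReal.ofReal (Real.exp (-r)) * κ n (Set.Ici (-r))
            * ∫⁻ y, ENNReal.ofReal (min (Real.exp y) M) ∂ν := by gcongr; exact hr n
      _ = ∫⁻ x in Set.Ici (-r), ENNReal.ofReal (Real.exp (-r))
            * ∫⁻ y, ENNReal.ofReal (min (Real.exp y) M) ∂ν ∂κ n := by
          rw [setLIntegral_const]; ring
      _ ≤ ∫⁻ x in Set.Ici (-r), ∫⁻ y, ENNReal.ofReal (min (Real.exp (x + y)) M) ∂ν ∂κ n := by
          refine setLIntegral_mono' measurableSet_Ici fun x hx => ?_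
          rw [← lintegral_const_mul _ (by fun_prop)]
          refine lintegral_mono fun y => ?_
          rw [← ENNReal.ofReal_mul (Real.exp_pos _).le]
          refine ENNReal.ofReal_le_ofReal (le_min ?_ ?_)
          · calc Real.exp (-r) * min (Real.exp y) M ≤ Real.exp x * Real.exp y := by
                  gcongr
                  · exact hx
                  · exact min_le_left _ _
              _ = _ := (Real.exp_add _ _).symm
          · calc Real.exp (-r) * min (Real.exp y) M ≤ 1 * M := by
                  gcongr
                  · exact Real.exp_le_one_iff.2 (by linarith)
                  · exact min_le_right _ _
              _ = M := one_mul _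
      _ ≤ _ := setLIntegral_le_lintegral _ _
  have hle : ∫⁻ y, ENNReal.ofReal (Real.exp y) ∂ν
      ≤ liminf (fun M : ℕ => ∫⁻ y, ENNReal.ofReal (min (Real.exp y) M) ∂ν) atTop := by
    refine le_trans (le_of_eq ?_) (lintegral_liminf_le fun M => by fun_prop)
    refine lintegral_congr fun y => (Tendsto.liminf_eq ?_).symm
    refine tendsto_const_nhds.congr' ?_
    filter_upwards [eventually_ge_atTop ⌈Real.exp y⌉₊] with M hM'
    rw [min_eq_left ((Nat.le_ceil _).trans (by exact_mod_cast hM'))]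
  refine hle.trans_lt (lt_of_le_of_lt (b := (∫⁻ x, ENNReal.ofReal (Real.exp x) ∂μ) / D) ?_ ?_)
  · refine (liminf_le_liminf (Eventually.of_forall fun M => ?_)).trans_eq (liminf_const _)
    rw [ENNReal.le_div_iff_mul_le (Or.inl hD0) (Or.inl hDt), mul_comm]
    exact hM M
  · exact ENNReal.div_lt_top hμ.ne hD0

end CompoundPoisson

/-! ### Exponential moments of the Lévy measure -/

section ExponentialMoment

variable {d : ℕ} {μ ν : Measure (EuclideanSpace ℝ (Fin d))} {A : Matrix (Fin d) (Fin d) ℝ}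
  {b : EuclideanSpace ℝ (Fin d)}

lemma HasLevyTriplet.charFun_eq_exp_levyPsi (h : HasLevyTriplet μ A ν b)
    (a u : EuclideanSpace ℝ (Fin d)) : charFun μ u = cexp (levyPsi A ν b 0 a u) := by
  rw [h.charFun_eq, levyPsi]
  congr 2
  · simp
    ring
  · refine integral_congr_ae (ae_of_all _ fun x => ?_)
    simp [levyKernel]

lemma inner_toEuclideanLin_self_nonneg (hA : A.PosSemidef) (u : EuclideanSpace ℝ (Fin d)) :
    0 ≤ inner ℝ u (A.toEuclideanLin u) := by
  have h := hA.dotProduct_mulVec_nonneg u.ofLp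
  simpa [EuclideanSpace.inner_eq_star_dotProduct, dotProduct_comm] using h

lemma charFun_compoundPoisson_map_inner {T : Set (EuclideanSpace ℝ (Fin d))}
    (hT : ν T < ⊤) (a : EuclideanSpace ℝ (Fin d)) (t : ℝ) :
    charFun (compoundPoisson ((ν.restrict T).map fun x => inner ℝ a x)) t
      = cexp (∫ x in T, (cexp (I * (inner ℝ (t • a) x : ℝ)) - 1) ∂ν) := by
  have : IsFiniteMeasure (ν.restrict T) := ⟨by simpa using hT⟩
  rw [charFun_compoundPoisson, charFun_sub_measureReal_univ,
    integral_map (by fun_prop) (by fun_prop)]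
  simp only [inner_smul_left, conj_trivial]

/-- The exponent of the Lévy–Khintchine formula with jumps of norm at most `r` removed is that of
a Gaussian law convolved with two compound Poisson laws. -/
lemma charFun_levy_approx (hν : IsLevyMeasure ν) (hA : A.PosSemidef)
    (a b : EuclideanSpace ℝ (Fin d)) {r : ℝ} (hr : 0 < r) (hr1 : r ≤ 1) (t : ℝ) :
    charFun ((ProbabilityTheory.gaussianReal
        (inner ℝ b a - ∫ x in {x | r < ‖x‖} \ {x | 1 < ‖x‖}, inner ℝ a x ∂ν)
        (inner ℝ a (A.toEuclideanLin a)).toNNReal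
      ∗ compoundPoisson ((ν.restrict ({x | r < ‖x‖} \ {x | 1 < ‖x‖})).map fun x => inner ℝ a x))
      ∗ compoundPoisson ((ν.restrict {x | 1 < ‖x‖}).map fun x => inner ℝ a x)) t
    = cexp (I * (inner ℝ b (t • a) : ℝ)
        - 1 / 2 * (inner ℝ (t • a) (A.toEuclideanLin (t • a)) : ℝ)
        + ∫ x in {x | r < ‖x‖}, levyKernel 0 0 (t • a) x ∂ν) := by
  set S : Set (EuclideanSpace ℝ (Fin d)) := {x | 1 < ‖x‖} with hS
  set T : Set (EuclideanSpace ℝ (Fin d)) := {x | r < ‖x‖} \ S with hT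
  have hSm : MeasurableSet S := measurableSet_lt_norm 1
  have hTm : MeasurableSet T := (measurableSet_lt_norm r).diff hSm
  have hSf : ν S < ⊤ := hν.measure_lt_norm_lt_top one_pos
  have hTf : ν T < ⊤ := (measure_mono Set.sdiff_subset).trans_lt (hν.measure_lt_norm_lt_top hr)
  have hTS : {x : EuclideanSpace ℝ (Fin d) | r < ‖x‖} = T ∪ S := by
    rw [hT, Set.sdiff_union_self, Set.union_eq_left.2]
    exact fun x hx => lt_of_le_of_lt hr1 hx
  have : IsFiniteMeasure (ν.restrict S) := ⟨by simpa using hSf⟩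
  have : IsFiniteMeasure (ν.restrict T) := ⟨by simpa using hTf⟩
  have hK : Integrable (levyKernel 0 0 (t • a)) ν :=
    integrable_levyKernel hν.integrable_levyDom_zero (by simp) _
  have hE : Integrable (fun x => cexp (I * (inner ℝ (t • a) x : ℝ)) - 1) (ν.restrict T) := by
    refine Integrable.sub ?_ (integrable_const _)
    refine (integrable_const (1 : ℝ)).mono' (by fun_prop) (ae_of_all _ fun x => ?_)
    rw [mul_comm, Complex.norm_exp_ofReal_mul_I]
  have hI : Integrable (fun x => (inner ℝ a x : ℝ)) (ν.restrict T) := by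
    refine (integrable_const ‖a‖).mono' (by fun_prop) ?_
    filter_upwards [ae_restrict_mem hTm] with x hx
    have hx1 : ‖x‖ ≤ 1 := not_lt.1 hx.2
    calc ‖inner ℝ a x‖ ≤ ‖a‖ * ‖x‖ := norm_inner_le_norm _ _
      _ ≤ ‖a‖ * 1 := by gcongr
      _ = ‖a‖ := mul_one _
  have hI' : Integrable (fun x => I * t * ((inner ℝ a x : ℝ) : ℂ)) (ν.restrict T) :=
    (hI.ofReal (𝕜 := ℂ)).const_mul (I * t)
  -- On `T` the truncation function is 1, so the compensator contributes a term linear in t; it is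
  -- absorbed in the shifted mean of the Gaussian law. On `S` there is no compensator.
  have hint : ∫ x in {x | r < ‖x‖}, levyKernel 0 0 (t • a) x ∂ν
      = (∫ x in T, (cexp (I * (inner ℝ (t • a) x : ℝ)) - 1) ∂ν)
        - I * t * ((∫ x in T, inner ℝ a x ∂ν : ℝ) : ℂ)
        + ∫ x in S, (cexp (I * (inner ℝ (t • a) x : ℝ)) - 1) ∂ν := by
    rw [hTS, setIntegral_union Set.disjoint_sdiff_left hSm hK.integrableOn hK.integrableOn,
      ← integral_complex_ofReal, ← integral_const_mul, ← integral_sub hE hI']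
    congr 1
    · refine setIntegral_congr_fun hTm fun x hx => ?_
      simp only [levyKernel, levyTrunc_of_norm_le (not_lt.1 hx.2), inner_smul_left, conj_trivial]
      push_cast
      ring_nf
    · refine setIntegral_congr_fun hSm fun x hx => ?_
      simp [levyKernel, levyTrunc_of_lt_norm hx]
  rw [charFun_conv, charFun_conv, ProbabilityTheory.charFun_gaussianReal,
    charFun_compoundPoisson_map_inner hTf, charFun_compoundPoisson_map_inner hSf,
    ← Complex.exp_add, ← Complex.exp_add, hint]
  congr 1
  simp only [inner_smul_left, inner_smul_right, map_smul, conj_trivial,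
    Real.coe_toNNReal _ (inner_toEuclideanLin_self_nonneg hA a)]
  push_cast
  ring

/-- The laws of `charFun_levy_approx` for r = 1/(n+1) converge weakly to the law of ⟨a, ξ⟩. All of
them contain the same compound Poisson factor built from the jumps of norm above 1, so
`lintegral_exp_lt_top_of_tendsto_charFun` bounds the exponential moment of these jumps. -/
theorem HasLevyTriplet.integrable_levyDom [IsProbabilityMeasure μ] (h : HasLevyTriplet μ A ν b)
    {a : EuclideanSpace ℝ (Fin d)} (ha : Integrable (fun x => Real.exp (inner ℝ a x)) μ) :
    Integrable (levyDom a) ν := by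
  have hν := h.isLevyMeasure
  set S : Set (EuclideanSpace ℝ (Fin d)) := {x | 1 < ‖x‖} with hS
  have hSm : MeasurableSet S := measurableSet_lt_norm 1
  have hSf : ν S < ⊤ := hν.measure_lt_norm_lt_top one_pos
  have : IsFiniteMeasure (ν.restrict S) := ⟨by simpa using hSf⟩
  have hr0 (n : ℕ) : (0 : ℝ) < 1 / (n + 1) := Nat.one_div_pos_of_nat
  have hr1 (n : ℕ) : (1 : ℝ) / (n + 1) ≤ 1 := by
    rw [div_le_one (by positivity)]; linarith [(Nat.cast_nonneg n : (0 : ℝ) ≤ n)]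
  have (n : ℕ) : IsFiniteMeasure (ν.restrict ({x | (1 : ℝ) / (n + 1) < ‖x‖} \ S)) :=
    ⟨by simpa using (measure_mono Set.sdiff_subset).trans_lt (hν.measure_lt_norm_lt_top (hr0 n))⟩
  have : IsProbabilityMeasure (μ.map fun x => inner ℝ a x) :=
    Measure.isProbabilityMeasure_map (by fun_prop)
  have hfin : ∫⁻ x, ENNReal.ofReal (Real.exp x) ∂((ν.restrict S).map fun x => inner ℝ a x) < ⊤ := by
    refine lintegral_exp_lt_top_of_tendsto_charFun (μ := μ.map fun x => inner ℝ a x)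
      (κ := fun n : ℕ => ProbabilityTheory.gaussianReal
        (inner ℝ b a - ∫ x in {x | (1 : ℝ) / (n + 1) < ‖x‖} \ S, inner ℝ a x ∂ν)
        (inner ℝ a (A.toEuclideanLin a)).toNNReal
      ∗ compoundPoisson
        ((ν.restrict ({x | (1 : ℝ) / (n + 1) < ‖x‖} \ S)).map fun x => inner ℝ a x))
      (fun t => ?_) ?_
    · have hchar : charFun (μ.map fun x => inner ℝ a x) t = charFun μ (t • a) := by
        rw [charFun_apply_real, charFun_apply, integral_map (by fun_prop) (by fun_prop)]
        simp only [inner_smul_right, real_inner_comm a]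
        push_cast
        rfl
      simp only [hS, charFun_levy_approx hν h.posSemidef a b (hr0 _) (hr1 _) t]
      rw [hchar, h.charFun_eq]
      refine (Complex.continuous_exp.tendsto _).comp (tendsto_const_nhds.add ?_)
      have hK : Integrable (levyKernel 0 0 (t • a)) ν :=
        integrable_levyKernel hν.integrable_levyDom_zero (by simp) _
      have hlim := tendsto_setIntegral_of_monotone (μ := ν)
        (s := fun n : ℕ => {x : EuclideanSpace ℝ (Fin d) | (1 : ℝ) / (n + 1) < ‖x‖})
        (fun n => measurableSet_lt_norm _)
        (fun n k hnk => Set.ofPred_subset_ofPred.2 fun x hx =>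
          lt_of_le_of_lt (Nat.one_div_le_one_div hnk) hx)
        hK.integrableOn
      -- Only the origin is missed, and a Lévy measure does not charge it.
      have hU : ν.restrict (⋃ n : ℕ, {x : EuclideanSpace ℝ (Fin d) | (1 : ℝ) / (n + 1) < ‖x‖})
          = ν := by
        refine Measure.restrict_eq_self_of_ae_mem ?_
        have h0 : ∀ᵐ x ∂ν, x ≠ 0 := by
          rw [ae_iff]
          simpa using hν.measure_zero
        filter_upwards [h0] with x hx
        obtain ⟨n, hn⟩ := exists_nat_one_div_lt (norm_pos_iff.2 hx)
        exact Set.mem_iUnion.2 ⟨n, hn⟩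
      rw [hU] at hlim
      convert hlim using 4 with x
      simp [levyKernel]
    · rw [lintegral_map (by fun_prop) (by fun_prop)]
      exact ((hasFiniteIntegral_iff_ofReal (ae_of_all _ fun x => (Real.exp_pos _).le)).1 ha.2)
  refine hν.integrable_min.add ?_
  rw [integrable_indicator_iff hSm]
  refine ⟨by fun_prop, ?_⟩
  rw [hasFiniteIntegral_iff_ofReal (ae_of_all _ fun x => (Real.exp_pos _).le)]
  rwa [lintegral_map (by fun_prop) (by fun_prop)] at hfin

end ExponentialMoment

/-! ### Holomorphic functions on the strip -/

/-- Differentiation under the integral sign for a locally dominated family of entire functions. -/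
lemma diffContOnCl_integral_of_dominated {X : Type*} [MeasurableSpace X] {μ : Measure X}
    {F : ℂ → X → ℂ} {U : Set ℂ} (hU : IsOpen U)
    (hmeas : ∀ z, AEStronglyMeasurable (F z) μ) (hdiff : ∀ x, Differentiable ℂ fun z => F z x)
    (hbound : ∀ R : ℝ, ∃ g : X → ℝ, Integrable g μ ∧
      ∀ z ∈ closure U, ‖z‖ ≤ R → ∀ x, ‖F z x‖ ≤ g x) :
    DiffContOnCl ℂ (fun z => ∫ x, F z x ∂μ) U := by
  constructor
  · intro z₀ hz₀
    obtain ⟨ε, hε, hball⟩ := Metric.isOpen_iff.1 hU z₀ hz₀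
    obtain ⟨g, hg, hFg⟩ := hbound (‖z₀‖ + ε)
    have hdom (z : ℂ) (hz : z ∈ Metric.ball z₀ ε) (x : X) : ‖F z x‖ ≤ g x := by
      refine hFg z (subset_closure (hball hz)) ?_ x
      have : ‖z - z₀‖ < ε := by rwa [← dist_eq_norm]
      calc ‖z‖ = ‖z₀ + (z - z₀)‖ := by ring_nf
        _ ≤ ‖z₀‖ + ‖z - z₀‖ := norm_add_le _ _
        _ ≤ ‖z₀‖ + ε := by linarith
    -- The derivative is a pointwise limit of difference quotients along 1/(n+1).
    have hderiv : AEStronglyMeasurable (fun x => deriv (fun z => F z x) z₀) μ := by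
      have ht : Tendsto (fun n : ℕ => (1 / ((n : ℂ) + 1))) atTop (𝓝[≠] 0) := by
        refine tendsto_nhdsWithin_iff.2
          ⟨tendsto_one_div_add_atTop_nhds_zero_nat (𝕜 := ℂ), Eventually.of_forall fun n => ?_⟩
        exact one_div_ne_zero (Nat.cast_add_one_ne_zero n)
      refine aestronglyMeasurable_of_tendsto_ae atTop
        (f := fun (n : ℕ) x => (1 / ((n : ℂ) + 1))⁻¹ • (F (z₀ + 1 / ((n : ℂ) + 1)) x - F z₀ x))
        (fun n => ((hmeas _).sub (hmeas _)).const_smul (1 / ((n : ℂ) + 1))⁻¹)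
        (ae_of_all _ fun x => ?_)
      exact (hasDerivAt_iff_tendsto_slope_zero.1 (hdiff x z₀).hasDerivAt).comp ht
    have key := hasDerivAt_integral_of_dominated_loc_of_deriv_le (μ := μ) (F := F)
      (F' := fun z x => deriv (fun z => F z x) z) (x₀ := z₀) (s := Metric.ball z₀ (ε / 2))
      (bound := fun x => g x / (ε / 2))
      (Metric.ball_mem_nhds _ (half_pos hε)) (Eventually.of_forall hmeas)
      (hg.mono' (hmeas z₀) (ae_of_all _ (hdom z₀ (Metric.mem_ball_self hε)))) hderiv
      (ae_of_all _ fun x z hz => ?_) (hg.div_const _)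
      (ae_of_all _ fun x z _ => (hdiff x z).hasDerivAt)
    · exact key.2.differentiableAt.differentiableWithinAt
    -- Cauchy's estimate: circles of radius ε/2 about points of the ball of radius ε/2 stay in the
    -- ball of radius ε, where `g` dominates.
    · refine norm_deriv_le_of_forall_mem_sphere_norm_le (half_pos hε) (hdiff x).diffContOnCl
        fun ζ hζ => hdom ζ ?_ x
      have h1 : dist ζ z = ε / 2 := hζ
      have h2 : dist z z₀ < ε / 2 := hz
      exact (dist_triangle ζ z z₀).trans_lt (by linarith)
  · intro z₀ hz₀
    obtain ⟨g, hg, hFg⟩ := hbound (‖z₀‖ + 1)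
    refine continuousWithinAt_of_dominated (bound := g) (Eventually.of_forall hmeas) ?_ hg
      (ae_of_all _ fun x => (hdiff x).continuous.continuousWithinAt)
    have h1 : ∀ᶠ z in 𝓝[closure U] z₀, ‖z‖ < ‖z₀‖ + 1 :=
      (continuous_norm.continuousAt.eventually_lt_const (by simp)).filter_mono nhdsWithin_le_nhds
    filter_upwards [h1, self_mem_nhdsWithin] with z hz hzU
    exact ae_of_all _ (hFg z hzU hz.le)

lemma isOpen_verticalStrip (a b : ℝ) : IsOpen (verticalStrip a b) :=
  isOpen_Ioo.preimage Complex.continuous_re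

lemma closure_verticalStrip_zero_one : closure (verticalStrip 0 1) = verticalClosedStrip 0 1 := by
  rw [verticalStrip, verticalClosedStrip, ← closure_Ioo zero_ne_one, closure_preimage_re]

/-- A bounded function on the closed strip that is holomorphic inside is determined by its values
on one boundary line. -/
lemma eqOn_verticalClosedStrip_of_eq_on_re_zero {f g : ℂ → ℂ} {C D : ℝ}
    (hf : DiffContOnCl ℂ f (verticalStrip 0 1)) (hg : DiffContOnCl ℂ g (verticalStrip 0 1))
    (hfC : ∀ z ∈ verticalClosedStrip 0 1, ‖f z‖ ≤ C)
    (hgD : ∀ z ∈ verticalClosedStrip 0 1, ‖g z‖ ≤ D)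
    (h0 : ∀ θ : ℝ, f (θ * I) = g (θ * I)) : Set.EqOn f g (verticalClosedStrip 0 1) := by
  intro z hz
  have hB : BddAbove ((norm ∘ fun z => f z - g z) '' verticalClosedStrip 0 1) := by
    refine ⟨C + D, ?_⟩
    rintro _ ⟨w, hw, rfl⟩
    exact (norm_sub_le _ _).trans (add_le_add (hfC w hw) (hgD w hw))
  have key := norm_le_interpStrip_of_mem_verticalClosedStrip₀₁ (fun z => f z - g z) hz
    (hf.sub hg) hB
  have hsup : sSupNormIm (fun z => f z - g z) 0 = 0 := by
    rw [sSupNormIm]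
    have : (norm ∘ fun z => f z - g z) '' (re ⁻¹' {0}) = {0} := by
      ext r
      constructor
      · rintro ⟨w, hw, rfl⟩
        have hw' : w = (w.im : ℂ) * I := by
          apply Complex.ext <;> simp
          exact hw
        rw [Function.comp_apply, hw', h0, sub_self, norm_zero]
        rfl
      · rintro rfl
        refine ⟨0, by simp, ?_⟩
        have := h0 0
        simp only [ofReal_zero, zero_mul] at this
        simp [this]
    rw [this, csSup_singleton]
  -- The three lines bound is set to zero as soon as one boundary supremum vanishes, so it also
  -- covers the line re z = 1.
  rw [interpStrip_eq_of_zero _ _ (Or.inl hsup), norm_zero] at key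
  exact sub_eq_zero.1 (norm_le_zero_iff.1 key)

/-! ### Analytic continuation of the Lévy–Khintchine formula -/

section Strip

variable {d : ℕ} {μ ν : Measure (EuclideanSpace ℝ (Fin d))} {A : Matrix (Fin d) (Fin d) ℝ}
  {a b : EuclideanSpace ℝ (Fin d)}

lemma differentiable_levyKernel (a w x : EuclideanSpace ℝ (Fin d)) :
    Differentiable ℂ fun z => levyKernel z a w x := by
  unfold levyKernel
  fun_prop

lemma diffContOnCl_integral_levyKernel (hd : Integrable (levyDom a) ν)
    (w : EuclideanSpace ℝ (Fin d)) :
    DiffContOnCl ℂ (fun z => ∫ x, levyKernel z a w x ∂ν) (verticalStrip 0 1) := by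
  refine diffContOnCl_integral_of_dominated (isOpen_verticalStrip 0 1)
    (fun z => (measurable_levyKernel z a w).aestronglyMeasurable)
    (differentiable_levyKernel a w) fun R => ?_
  refine ⟨fun x => ((R * ‖a‖ + ‖w‖) ^ 2 * Real.exp (R * ‖a‖ + ‖w‖) + 2) * levyDom a x,
    hd.const_mul _, fun z hz hzR x => norm_levyKernel_le ?_ (by gcongr) x⟩
  rwa [closure_verticalStrip_zero_one] at hz

lemma diffContOnCl_integral_exp [IsFiniteMeasure μ]
    (ha : Integrable (fun x => Real.exp (inner ℝ a x)) μ) (w : EuclideanSpace ℝ (Fin d)) :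
    DiffContOnCl ℂ (fun z => ∫ x, cexp (z * (inner ℝ a x : ℝ) + I * (inner ℝ w x : ℝ)) ∂μ)
      (verticalStrip 0 1) := by
  refine diffContOnCl_integral_of_dominated (isOpen_verticalStrip 0 1)
    (fun z => by fun_prop) (fun x => by fun_prop) fun R => ?_
  refine ⟨fun x => 1 + Real.exp (inner ℝ a x), (integrable_const _).add ha,
    fun z hz _ x => norm_exp_le_one_add_exp ?_ _ _⟩
  rwa [closure_verticalStrip_zero_one] at hz

lemma inner_toEuclideanLin_comm (hA : A.IsHermitian) (u v : EuclideanSpace ℝ (Fin d)) :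
    inner ℝ u (A.toEuclideanLin v) = inner ℝ v (A.toEuclideanLin u) := by
  rw [← (Matrix.isSymmetric_toEuclideanLin_iff.2 hA) u v, real_inner_comm]

/-- The imaginary part of the argument only turns the exponential, which is replaced by its modulus,
and it does not enter the real part of the compensator. -/
lemma levyKernel_re_le (z : ℂ) (a w x : EuclideanSpace ℝ (Fin d)) :
    (levyKernel z a w x).re ≤ (levyKernel z.re a 0 x).re := by
  simp only [levyKernel, sub_re, exp_re, add_re, mul_re, ofReal_re, ofReal_im, I_re, I_im,
    add_im, mul_im, one_re, inner_zero_left, Real.cos_zero, mul_zero, zero_mul, sub_zero, add_zero,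
    mul_one]
  have := Real.cos_le_one (z.re * 0 + z.im * inner ℝ a x + (0 * 0 + 1 * inner ℝ w x))
  gcongr
  exact mul_le_of_le_one_right (Real.exp_pos _).le (Real.cos_le_one _)

/-- The bound has to be uniform in im z, so that exp ψ is bounded on the whole strip;
`norm_levyKernel_le` grows with |z| and is applied only at the real point re z. -/
lemma levyPsi_re_le (hA : A.PosSemidef) (hd : Integrable (levyDom a) ν)
    (w : EuclideanSpace ℝ (Fin d)) {z : ℂ} (hz : z.re ∈ Set.Icc (0 : ℝ) 1) :
    (levyPsi A ν b z a w).re ≤ |inner ℝ b a| + 1 / 2 * inner ℝ a (A.toEuclideanLin a)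
      + (‖a‖ ^ 2 * Real.exp ‖a‖ + 2) * ∫ x, levyDom a x ∂ν := by
  have hint : (∫ x, levyKernel z a w x ∂ν).re
      ≤ (‖a‖ ^ 2 * Real.exp ‖a‖ + 2) * ∫ x, levyDom a x ∂ν := by
    have hK := integrable_levyKernel hd hz w
    rw [← integral_const_mul]
    have hre := integral_re hK
    simp only [RCLike.re_eq_complex_re] at hre
    rw [← hre]
    refine integral_mono hK.re (hd.const_mul _) fun x => ?_
    refine (levyKernel_re_le z a w x).trans ((Complex.re_le_norm _).trans ?_)
    refine norm_levyKernel_le (by simpa using hz) ?_ x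
    simp only [norm_zero, add_zero, Complex.norm_real, Real.norm_eq_abs, abs_of_nonneg hz.1]
    exact mul_le_of_le_one_left (norm_nonneg _) hz.2
  -- All quadratic terms that involve im z or w add up to minus one half of this non-negative value.
  have hq := inner_toEuclideanLin_self_nonneg hA (w + z.im • a)
  simp only [map_add, map_smul, inner_add_left, inner_add_right, inner_smul_left,
    inner_smul_right, conj_trivial, inner_toEuclideanLin_comm hA.1 w a] at hq
  have hqa := inner_toEuclideanLin_self_nonneg hA a
  set q := inner ℝ a (A.toEuclideanLin a)
  set p := inner ℝ a (A.toEuclideanLin w)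
  set r := inner ℝ w (A.toEuclideanLin w)
  have h1 : z.re * inner ℝ b a ≤ |inner ℝ b a| := by
    calc z.re * inner ℝ b a ≤ z.re * |inner ℝ b a| := by
          gcongr
          · exact hz.1
          · exact le_abs_self _
      _ ≤ |inner ℝ b a| := mul_le_of_le_one_left (abs_nonneg _) hz.2
  have h2 : z.re ^ 2 * q ≤ q := mul_le_of_le_one_left hqa (pow_le_one₀ hz.1 hz.2)
  have hΨ : (levyPsi A ν b z a w).re = z.re * inner ℝ b a
      + 1 / 2 * ((z.re ^ 2 - z.im ^ 2) * q - 2 * z.im * p - r)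
      + (∫ x, levyKernel z a w x ∂ν).re := by
    have h3 : (z ^ 2 * (q : ℂ) + 2 * I * z * (p : ℂ) - (r : ℂ)).re
        = (z.re ^ 2 - z.im ^ 2) * q - 2 * z.im * p - r := by
      simp [pow_two, sub_eq_add_neg]
    have h4 : (1 / 2 : ℂ) = ((1 / 2 : ℝ) : ℂ) := by norm_num
    rw [levyPsi, h4, add_re, add_re, add_re, re_ofReal_mul, h3]
    simp
  rw [hΨ]
  linarith

lemma diffContOnCl_levyPsi (hd : Integrable (levyDom a) ν) (w : EuclideanSpace ℝ (Fin d)) :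
    DiffContOnCl ℂ (fun z => levyPsi A ν b z a w) (verticalStrip 0 1) := by
  unfold levyPsi
  refine DiffContOnCl.add (Differentiable.diffContOnCl ?_) (diffContOnCl_integral_levyKernel hd w)
  fun_prop

lemma levyPsi_mul_I (hA : A.PosSemidef) (θ : ℝ) (w : EuclideanSpace ℝ (Fin d)) :
    levyPsi A ν b (θ * I) a w = levyPsi A ν b 0 0 (θ • a + w) := by
  simp only [levyPsi, levyKernel_zero_smul, inner_add_left, inner_add_right, inner_smul_left,
    inner_smul_right, map_add, map_smul, conj_trivial, inner_toEuclideanLin_comm hA.1 w a,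
    inner_zero_right, inner_zero_left]
  push_cast
  linear_combination (1 / 2 * θ ^ 2 * ((inner ℝ a (A.toEuclideanLin a) : ℝ) : ℂ)
    + θ * ((inner ℝ a (A.toEuclideanLin w) : ℝ) : ℂ)) * I_sq

/-- The Lévy–Khintchine formula extends to complex arguments with real part `a` if the exponential
moment in the direction `a` is finite. -/
theorem HasLevyTriplet.integral_exp_eq [IsProbabilityMeasure μ] (h : HasLevyTriplet μ A ν b)
    (ha : Integrable (fun x => Real.exp (inner ℝ a x)) μ) (w : EuclideanSpace ℝ (Fin d)) :
    ∫ x, cexp ((inner ℝ a x : ℝ) + I * (inner ℝ w x : ℝ)) ∂μ = cexp (levyPsi A ν b 1 a w) := by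
  have hd := h.integrable_levyDom ha
  -- Both sides with ⟨a, x⟩ multiplied by z agree at z = iθ by the real formula at θa + w; the claim
  -- is the value at z = 1.
  have key := eqOn_verticalClosedStrip_of_eq_on_re_zero
    (C := ∫ x, (1 + Real.exp (inner ℝ a x)) ∂μ)
    (D := Real.exp (|inner ℝ b a| + 1 / 2 * inner ℝ a (A.toEuclideanLin a)
      + (‖a‖ ^ 2 * Real.exp ‖a‖ + 2) * ∫ x, levyDom a x ∂ν))
    (diffContOnCl_integral_exp ha w)
    (Complex.differentiable_exp.comp_diffContOnCl
      (diffContOnCl_levyPsi (A := A) (b := b) hd w))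
    (fun z hz => ?_) (fun z hz => ?_) (fun θ => ?_) (x := 1) (by simp [verticalClosedStrip])
  · simpa using key
  · exact norm_integral_le_of_norm_le ((integrable_const _).add ha)
      (ae_of_all _ fun x => norm_exp_le_one_add_exp hz _ _)
  · rw [Function.comp_apply, Complex.norm_exp]
    exact Real.exp_le_exp.2 (levyPsi_re_le h.posSemidef hd w hz)
  · rw [Function.comp_apply, levyPsi_mul_I h.posSemidef, ← h.charFun_eq_exp_levyPsi, charFun_apply]
    refine integral_congr_ae (ae_of_all _ fun x => ?_)
    simp only [inner_add_right, inner_smul_right, real_inner_comm a, real_inner_comm w]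
    push_cast
    ring_nf

end Strip

/-! ### Means of the coordinates of e^ξ -/

section Marginal

variable {d : ℕ} {μ ν : Measure (EuclideanSpace ℝ (Fin d))} {A : Matrix (Fin d) (Fin d) ℝ}
  {b : EuclideanSpace ℝ (Fin d)}

lemma inner_single_one (i : Fin d) (x : EuclideanSpace ℝ (Fin d)) :
    inner ℝ (EuclideanSpace.single i 1) x = x i := by
  simp [EuclideanSpace.inner_single_left]

lemma levyKernel_single (i : Fin d) (x : EuclideanSpace ℝ (Fin d)) :
    levyKernel 1 (EuclideanSpace.single i 1) 0 x = (expCompensated i x : ℝ) := by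
  simp [levyKernel, expCompensated, inner_single_one]

lemma integrable_expCompensated (i : Fin d)
    (hd : Integrable (levyDom (EuclideanSpace.single i 1)) ν) :
    Integrable (expCompensated i) ν := by
  have h := (integrable_levyKernel hd (z := 1) (by simp) 0).re
  refine h.congr (ae_of_all _ fun x => ?_)
  simp only [levyKernel_single]
  rfl

lemma toEuclideanLin_single_apply (i j : Fin d) :
    A.toEuclideanLin (EuclideanSpace.single i 1) j = A j i := by
  simp

lemma levyPsi_single (i : Fin d) :
    levyPsi A ν b 1 (EuclideanSpace.single i 1) 0 = (levyExponent A ν b i : ℝ) := by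
  rw [levyPsi, levyExponent]
  simp only [levyKernel_single]
  rw [integral_complex_ofReal, real_inner_comm, inner_single_one, inner_single_one,
    toEuclideanLin_single_apply]
  simp

lemma HasLevyTriplet.integrable_levyDom_single [IsProbabilityMeasure μ]
    (h : HasLevyTriplet μ A ν b) (i : Fin d) (hi : Integrable (fun x => Real.exp (x i)) μ) :
    Integrable (levyDom (EuclideanSpace.single i 1)) ν :=
  h.integrable_levyDom (by simpa only [inner_single_one] using hi)

theorem HasLevyTriplet.integral_exp_apply [IsProbabilityMeasure μ]
    (h : HasLevyTriplet μ A ν b) (i : Fin d) (hi : Integrable (fun x => Real.exp (x i)) μ) :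
    ∫ x, Real.exp (x i) ∂μ = Real.exp (levyExponent A ν b i) := by
  have key := h.integral_exp_eq (a := EuclideanSpace.single i 1)
    (by simpa only [inner_single_one] using hi) 0
  simp only [inner_single_one, inner_zero_left, ofReal_zero, mul_zero, add_zero] at key
  rw [levyPsi_single, ← ofReal_exp] at key
  simp only [← ofReal_exp] at key
  rw [integral_complex_ofReal] at key
  exact_mod_cast key

end Marginal

/-! ### The coordinatewise exponential -/

section ExpVec

variable {d : ℕ}

@[fun_prop]
lemma measurable_expVec : Measurable (expVec (d := d)) := by
  unfold expVec
  fun_prop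

lemma expVec_apply (x : EuclideanSpace ℝ (Fin d)) (i : Fin d) : expVec x i = Real.exp (x i) := rfl

lemma measure_eq_of_map_expVec_eq {μ ν : Measure (EuclideanSpace ℝ (Fin d))}
    (h : μ.map expVec = ν.map expVec) : μ = ν := by
  let logVec : EuclideanSpace ℝ (Fin d) → EuclideanSpace ℝ (Fin d) :=
    fun x => WithLp.toLp 2 fun i => Real.log (x i)
  have hlog : Measurable logVec := by fun_prop
  have hcomp : logVec ∘ expVec = id := by
    funext x
    ext i
    simp [logVec, expVec_apply]
  have h' := congrArg (Measure.map logVec) h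
  rwa [Measure.map_map hlog measurable_expVec, Measure.map_map hlog measurable_expVec, hcomp,
    Measure.map_id, Measure.map_id] at h'

lemma integrable_exp_apply {μ : Measure (EuclideanSpace ℝ (Fin d))} (h : Integrable expVec μ)
    (i : Fin d) : Integrable (fun x : EuclideanSpace ℝ (Fin d) => Real.exp (x i)) μ := by
  refine h.norm.mono' (by fun_prop) (ae_of_all _ fun x => ?_)
  exact PiLp.norm_apply_le (expVec x) i

end ExpVec

/-! ### Measures determined by integrals of |c + ⟨u, x⟩| -/

/-- A finite measure on the line is determined by its mass and the integrals of `|x - c|`. -/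
lemma Measure.ext_of_integral_abs_sub {σ σ' : Measure ℝ} [IsFiniteMeasure σ] [IsFiniteMeasure σ']
    (hσ : Integrable id σ) (hσ' : Integrable id σ')
    (hmass : σ.real Set.univ = σ'.real Set.univ)
    (h : ∀ c : ℝ, ∫ x, |x - c| ∂σ = ∫ x, |x - c| ∂σ') : σ = σ' := by
  refine Measure.ext_of_Iic σ σ' fun c => ?_
  -- The right derivative of |x - c| in c is 1 for x ≤ c and -1 for x > c, and the difference
  -- quotients are bounded by 1. Integration gives the distribution function.
  have key (ρ : Measure ℝ) [IsFiniteMeasure ρ] (hρ : Integrable id ρ) :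
      Tendsto (fun n : ℕ => ((n : ℝ) + 1) * ((∫ x, |x - (c + 1 / ((n : ℝ) + 1))| ∂ρ)
        - ∫ x, |x - c| ∂ρ)) atTop (𝓝 (2 * ρ.real (Set.Iic c) - ρ.real Set.univ)) := by
    have hi (e : ℝ) : Integrable (fun x => |x - e|) ρ := (hρ.sub (integrable_const e)).abs
    have hlim : ∫ x, ((Set.Iic c).indicator (fun _ => (2 : ℝ)) x - 1) ∂ρ
        = 2 * ρ.real (Set.Iic c) - ρ.real Set.univ := by
      rw [integral_sub ((integrable_const _).indicator measurableSet_Iic) (integrable_const _),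
        integral_indicator_const _ measurableSet_Iic, integral_const]
      simp [mul_comm]
    rw [← hlim]
    simp only [← integral_sub (hi _) (hi _), ← integral_const_mul]
    refine tendsto_integral_of_dominated_convergence (fun _ => 1) (fun n => by fun_prop)
      (integrable_const _) (fun n => ae_of_all _ fun x => ?_) (ae_of_all _ fun x => ?_)
    · have hn : (0 : ℝ) < (n : ℝ) + 1 := by positivity
      rw [norm_mul, Real.norm_eq_abs, Real.norm_eq_abs, abs_of_pos hn, ← le_div_iff₀' hn]
      refine (abs_abs_sub_abs_le_abs_sub _ _).trans_eq ?_
      rw [show x - (c + 1 / ((n : ℝ) + 1)) - (x - c) = -(1 / ((n : ℝ) + 1)) by ring, abs_neg,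
        abs_of_pos (by positivity)]
    · rcases le_or_gt x c with hx | hx
      · refine tendsto_const_nhds.congr fun n => ?_
        have hn : (0 : ℝ) < (n : ℝ) + 1 := by positivity
        have hn' : 0 < 1 / ((n : ℝ) + 1) := by positivity
        rw [abs_of_nonpos (by linarith : x - c ≤ 0), abs_of_nonpos (by linarith),
          Set.indicator_of_mem (Set.mem_Iic.2 hx)]
        field_simp
        ring
      · refine tendsto_const_nhds.congr' ?_
        have h1 : ∀ᶠ n : ℕ in atTop, 1 / ((n : ℝ) + 1) < x - c :=
          tendsto_one_div_add_atTop_nhds_zero_nat.eventually_lt_const (sub_pos.2 hx)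
        filter_upwards [h1] with n hn1
        have hn : (0 : ℝ) < (n : ℝ) + 1 := by positivity
        rw [abs_of_pos (sub_pos.2 hx), abs_of_nonneg (by linarith),
          Set.indicator_of_notMem (by simpa using hx)]
        field_simp
        ring
  have h1 := key σ hσ
  simp only [h] at h1
  have h2 := tendsto_nhds_unique h1 (key σ' hσ')
  have h3 : σ.real (Set.Iic c) = σ'.real (Set.Iic c) := by linarith
  exact (measureReal_eq_measureReal_iff).1 h3

/-- A finite measure on a Euclidean space is determined by the integrals of the functions
`x ↦ |c + ⟪u, x⟫|`. -/
lemma Measure.ext_of_integral_abs_add_inner {E : Type*} [NormedAddCommGroup E]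
    [InnerProductSpace ℝ E] [CompleteSpace E] [MeasurableSpace E] [BorelSpace E]
    [SecondCountableTopology E] {ρ ρ' : Measure E} [IsFiniteMeasure ρ] [IsFiniteMeasure ρ']
    (hρ : Integrable id ρ) (hρ' : Integrable id ρ')
    (h : ∀ (c : ℝ) (u : E), ∫ x, |c + inner ℝ u x| ∂ρ = ∫ x, |c + inner ℝ u x| ∂ρ') :
    ρ = ρ' := by
  refine Measure.ext_of_charFun (funext fun u => ?_)
  have hmass : ρ.real Set.univ = ρ'.real Set.univ := by simpa using h 1 0
  have hm (σ : Measure E) : AEMeasurable (fun x => (inner ℝ u x : ℝ)) σ := by fun_prop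
  have hid {σ : Measure E} (hσ : Integrable id σ) :
      Integrable id (σ.map fun x => inner ℝ u x) := by
    rw [integrable_map_measure (by fun_prop) (hm σ)]
    exact hσ.const_inner u
  -- Cramér–Wold: the projections coincide, hence the characteristic functions do.
  have heq : (ρ.map fun x => inner ℝ u x) = ρ'.map fun x => inner ℝ u x := by
    refine Measure.ext_of_integral_abs_sub (hid hρ) (hid hρ') ?_ fun c => ?_
    · rw [map_measureReal_apply (by fun_prop) .univ, map_measureReal_apply (by fun_prop) .univ]
      simpa using hmass
    · rw [integral_map (hm ρ) (by fun_prop), integral_map (hm ρ') (by fun_prop)]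
      simpa only [sub_eq_neg_add] using h (-c) u
  have hc (σ : Measure E) : charFun σ u = charFun (σ.map fun x => inner ℝ u x) 1 := by
    rw [charFun_apply_real, charFun_apply, integral_map (hm σ) (by fun_prop)]
    simp [real_inner_comm u]
  rw [hc, hc, heq]

/-! ### Tilting by the last coordinate -/

section TiltLast

variable {m : ℕ} {μ μ' : Measure (EuclideanSpace ℝ (Fin (m + 1)))}

lemma matrixU_toEuclideanLin_apply (x : EuclideanSpace ℝ (Fin (m + 1))) (j : Fin m) :
    (matrixU m).toEuclideanLin x j = x j.castSucc - x (Fin.last m) := by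
  rw [Matrix.toLpLin_apply]
  simp only [Matrix.mulVec, dotProduct]
  rw [Fin.sum_univ_castSucc]
  simp [matrixU, sub_eq_add_neg]

@[fun_prop]
lemma measurable_matrixU :
    Measurable fun x : EuclideanSpace ℝ (Fin (m + 1)) => (matrixU m).toEuclideanLin x :=
  (LinearMap.continuous_of_finiteDimensional _).measurable

lemma integral_tiltLast {F : Type*} [NormedAddCommGroup F] [NormedSpace ℝ F]
    (g : EuclideanSpace ℝ (Fin (m + 1)) → F) :
    ∫ x, g x ∂tiltLast μ = ∫ x, Real.exp (x (Fin.last m)) • g x ∂μ := by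
  rw [tiltLast, integral_withDensity_eq_integral_toReal_smul (by fun_prop)
    (ae_of_all _ fun x => ENNReal.ofReal_lt_top)]
  simp only [ENNReal.toReal_ofReal (Real.exp_pos _).le]

lemma integrable_tiltLast_iff {F : Type*} [NormedAddCommGroup F] [NormedSpace ℝ F]
    {g : EuclideanSpace ℝ (Fin (m + 1)) → F} :
    Integrable g (tiltLast μ) ↔ Integrable (fun x => Real.exp (x (Fin.last m)) • g x) μ := by
  rw [tiltLast, integrable_withDensity_iff_integrable_smul' (by fun_prop)
    (ae_of_all _ fun x => ENNReal.ofReal_lt_top)]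
  simp only [ENNReal.toReal_ofReal (Real.exp_pos _).le]

lemma isFiniteMeasure_tiltLast (h : Integrable expVec μ) : IsFiniteMeasure (tiltLast μ) :=
  isFiniteMeasure_withDensity_ofReal (integrable_exp_apply h _).2

/-- The scalar products with `e^x` depend only on `x_d` and `U x`. -/
lemma exp_mul_abs_add_inner_expVec (c : ℝ) (u : EuclideanSpace ℝ (Fin m))
    (x : EuclideanSpace ℝ (Fin (m + 1))) :
    Real.exp (x (Fin.last m)) * |c + inner ℝ u (expVec ((matrixU m).toEuclideanLin x))|
      = |inner ℝ (WithLp.toLp 2 (Fin.snoc (α := fun _ => ℝ) u c)) (expVec x)| := by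
  conv_lhs => rw [← abs_of_pos (Real.exp_pos (x (Fin.last m))), ← abs_mul]
  congr 1
  simp only [PiLp.inner_apply, expVec_apply, matrixU_toEuclideanLin_apply, RCLike.inner_apply,
    conj_trivial]
  rw [Fin.sum_univ_castSucc, mul_add, Finset.mul_sum, add_comm]
  simp only [Fin.snoc_castSucc, Fin.snoc_last]
  congr 1
  refine Finset.sum_congr rfl fun j _ => ?_
  rw [Real.exp_sub]
  field_simp

lemma integral_abs_add_inner_map_tiltLast (c : ℝ) (u : EuclideanSpace ℝ (Fin m)) :
    ∫ y, |c + inner ℝ u (expVec y)| ∂(tiltLast μ).map (fun x => (matrixU m).toEuclideanLin x)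
      = ∫ x, |inner ℝ (WithLp.toLp 2 (Fin.snoc (α := fun _ => ℝ) u c)) (expVec x)| ∂μ := by
  rw [integral_map (by fun_prop) (by fun_prop), integral_tiltLast]
  simp only [smul_eq_mul, exp_mul_abs_add_inner_expVec]

lemma integrable_id_map_expVec (h : Integrable expVec μ) :
    Integrable id (((tiltLast μ).map fun x => (matrixU m).toEuclideanLin x).map expVec) := by
  rw [integrable_map_measure (by fun_prop) (by fun_prop),
    integrable_map_measure (by fun_prop) (by fun_prop), integrable_tiltLast_iff]
  have hsum : Integrable (fun x : EuclideanSpace ℝ (Fin (m + 1)) => ∑ i, Real.exp (x i)) μ :=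
    integrable_finsetSum _ fun i _ => integrable_exp_apply h i
  refine hsum.mono' (by fun_prop) (ae_of_all _ fun x => ?_)
  simp only [Function.comp_apply, id_eq]
  rw [norm_smul, Real.norm_eq_abs, abs_of_pos (Real.exp_pos _)]
  calc Real.exp (x (Fin.last m)) * ‖expVec ((matrixU m).toEuclideanLin x)‖
      ≤ Real.exp (x (Fin.last m)) * ∑ j : Fin m, Real.exp (x j.castSucc - x (Fin.last m)) := by
        gcongr
        rw [EuclideanSpace.norm_eq]
        refine Real.sqrt_le_iff.2 ⟨Finset.sum_nonneg fun _ _ => (Real.exp_pos _).le, ?_⟩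
        simp only [expVec_apply, matrixU_toEuclideanLin_apply, Real.norm_eq_abs, sq_abs]
        exact Finset.sum_sq_le_sq_sum_of_nonneg fun _ _ => (Real.exp_pos _).le
    _ = ∑ j : Fin m, Real.exp (x j.castSucc) := by
        rw [Finset.mul_sum]
        refine Finset.sum_congr rfl fun j _ => ?_
        rw [← Real.exp_add]
        ring_nf
    _ ≤ ∑ i, Real.exp (x i) := by
        rw [Fin.sum_univ_castSucc]
        linarith [Real.exp_pos (x (Fin.last m))]

/-- Equality of all `E|⟨u, e^ξ⟩|` amounts to equality of the laws of `U ξ` under the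
measures with density `e^{ξ_d}`. -/
theorem integral_abs_inner_expVec_eq_iff (h : Integrable expVec μ) (h' : Integrable expVec μ') :
    (∀ u, ∫ x, |inner ℝ u (expVec x)| ∂μ = ∫ x, |inner ℝ u (expVec x)| ∂μ')
      ↔ (tiltLast μ).map (fun x => (matrixU m).toEuclideanLin x)
        = (tiltLast μ').map fun x => (matrixU m).toEuclideanLin x := by
  have := isFiniteMeasure_tiltLast h
  have := isFiniteMeasure_tiltLast h'
  constructor
  · intro H
    refine measure_eq_of_map_expVec_eq (Measure.ext_of_integral_abs_add_inner
      (integrable_id_map_expVec h) (integrable_id_map_expVec h') fun c u => ?_)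
    rw [integral_map measurable_expVec.aemeasurable (by fun_prop),
      integral_map measurable_expVec.aemeasurable (by fun_prop),
      integral_abs_add_inner_map_tiltLast, integral_abs_add_inner_map_tiltLast]
    exact H _
  · intro H u
    have hu : u = WithLp.toLp 2 (Fin.snoc (α := fun _ => ℝ)
        (WithLp.toLp 2 (fun j : Fin m => u j.castSucc) : EuclideanSpace ℝ (Fin m))
        (u (Fin.last m))) := by
      ext i
      refine Fin.lastCases ?_ (fun j => ?_) i <;> simp
    rw [hu, ← integral_abs_add_inner_map_tiltLast, ← integral_abs_add_inner_map_tiltLast, H]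

end TiltLast

/-! ### Logarithms, continuity and second differences of the exponent -/

/-- Continuous logarithms of the same function that agree at one point are equal. -/
lemma eq_of_exp_eq_of_continuous {X : Type*} [TopologicalSpace X] [PreconnectedSpace X]
    {f g : X → ℂ} (hf : Continuous f) (hg : Continuous g) (h : ∀ x, cexp (f x) = cexp (g x))
    {x₀ : X} (h0 : f x₀ = g x₀) (x : X) : f x = g x := by
  have h1 (x : X) : ∃ n : ℤ, f x = g x + n * (2 * Real.pi * I) :=
    Complex.exp_eq_exp_iff_exists_int.1 (h x)
  choose n hn using h1
  have hpi : (2 * Real.pi * I : ℂ) ≠ 0 := Complex.two_pi_I_ne_zero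
  have hn' (x : X) : (n x : ℝ) = ((f x - g x) / (2 * Real.pi * I)).re := by
    rw [hn x, add_sub_cancel_left, mul_div_cancel_right₀ _ hpi, intCast_re]
  -- The integer jump between the logarithms depends continuously on the point, so it is constant on
  -- a connected space.
  have hc : Continuous n := by
    rw [Int.isClosedEmbedding_coe_real.isInducing.continuous_iff]
    refine Continuous.congr ?_ fun x => (hn' x).symm
    exact Complex.continuous_re.comp ((hf.sub hg).div_const _)
  have hn0 : n x₀ = 0 := by
    have := hn' x₀
    rw [h0, sub_self, zero_div, zero_re] at this
    exact_mod_cast this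
  have := PreconnectedSpace.constant inferInstance hc (x := x) (y := x₀)
  rw [hn x, this, hn0]
  simp

section ContinuityPsi

variable {d : ℕ} {μ ν : Measure (EuclideanSpace ℝ (Fin d))} {A : Matrix (Fin d) (Fin d) ℝ}
  {a b : EuclideanSpace ℝ (Fin d)}

lemma continuous_levyPsi (hd : Integrable (levyDom a) ν) :
    Continuous fun w => levyPsi A ν b 1 a w := by
  have hA : Continuous fun w => A.toEuclideanLin w :=
    LinearMap.continuous_of_finiteDimensional _
  have hint : Continuous fun w => ∫ x, levyKernel 1 a w x ∂ν := by
    refine continuous_iff_continuousAt.2 fun w₀ => ?_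
    refine continuousAt_of_dominated
      (bound := fun x => ((‖a‖ + (‖w₀‖ + 1)) ^ 2 * Real.exp (‖a‖ + (‖w₀‖ + 1)) + 2) * levyDom a x)
      (Eventually.of_forall fun w => (measurable_levyKernel 1 a w).aestronglyMeasurable) ?_
      (hd.const_mul _) (ae_of_all _ fun x => ?_)
    · filter_upwards [continuous_norm.continuousAt.eventually_lt_const
        (show ‖w₀‖ < ‖w₀‖ + 1 by simp)] with w hw
      exact ae_of_all _ fun x => norm_levyKernel_le (by simp) (by rw [norm_one, one_mul]; gcongr) x
    · unfold levyKernel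
      fun_prop
  unfold levyPsi
  fun_prop

/-- The symmetric second difference cancels everything affine in w, in particular the compensator.
-/
lemma levyKernel_second_difference (a w k x : EuclideanSpace ℝ (Fin d)) :
    levyKernel 1 a w x - 1 / 2 * (levyKernel 1 a (w + k) x + levyKernel 1 a (w - k) x)
      = cexp ((inner ℝ a x : ℝ) + I * (inner ℝ w x : ℝ)) * (1 - Real.cos (inner ℝ k x) : ℝ) := by
  have e1 : cexp (1 * ((inner ℝ a x : ℝ) : ℂ) + I * (inner ℝ (w + k) x : ℝ))
      = cexp ((inner ℝ a x : ℝ) + I * (inner ℝ w x : ℝ)) * cexp ((inner ℝ k x : ℝ) * I) := by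
    rw [← Complex.exp_add, inner_add_left]; push_cast; ring_nf
  have e2 : cexp (1 * ((inner ℝ a x : ℝ) : ℂ) + I * (inner ℝ (w - k) x : ℝ))
      = cexp ((inner ℝ a x : ℝ) + I * (inner ℝ w x : ℝ)) * cexp (-(inner ℝ k x : ℝ) * I) := by
    rw [← Complex.exp_add, inner_sub_left]; push_cast; ring_nf
  rw [levyKernel, levyKernel, levyKernel, e1, e2, ofReal_sub, ofReal_cos, Complex.cos,
    inner_add_left, inner_sub_left, one_mul]
  push_cast
  ring

lemma levyPsi_second_difference (hA : A.PosSemidef) (hd : Integrable (levyDom a) ν)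
    (w k : EuclideanSpace ℝ (Fin d)) :
    levyPsi A ν b 1 a w - 1 / 2 * (levyPsi A ν b 1 a (w + k) + levyPsi A ν b 1 a (w - k))
      = (1 / 2 * inner ℝ k (A.toEuclideanLin k) : ℝ)
        + ∫ x, cexp ((inner ℝ a x : ℝ) + I * (inner ℝ w x : ℝ))
            * (1 - Real.cos (inner ℝ k x) : ℝ) ∂ν := by
  have hK (w) : Integrable (levyKernel 1 a w) ν := integrable_levyKernel hd (by simp) w
  have h1 : ∫ x, levyKernel 1 a w x ∂ν - 1 / 2 * (∫ x, levyKernel 1 a (w + k) x ∂ν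
      + ∫ x, levyKernel 1 a (w - k) x ∂ν)
      = ∫ x, cexp ((inner ℝ a x : ℝ) + I * (inner ℝ w x : ℝ))
            * (1 - Real.cos (inner ℝ k x) : ℝ) ∂ν := by
    have h2 := integral_sub (hK w) (((hK (w + k)).add (hK (w - k))).const_mul (1 / 2))
    simp only [Pi.add_apply] at h2
    rw [← integral_add (hK _) (hK _), ← integral_const_mul, ← h2]
    simp only [← levyKernel_second_difference]
  rw [← h1]
  simp only [levyPsi, map_add, map_sub, inner_add_left, inner_add_right, inner_sub_left,
    inner_sub_right, inner_toEuclideanLin_comm hA.1 k w]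
  push_cast
  ring

lemma integrable_exp_mul_one_sub_cos (hd : Integrable (levyDom a) ν)
    (w k : EuclideanSpace ℝ (Fin d)) :
    Integrable (fun x => cexp ((inner ℝ a x : ℝ) + I * (inner ℝ w x : ℝ))
      * (1 - Real.cos (inner ℝ k x) : ℝ)) ν := by
  have hK (w) : Integrable (levyKernel 1 a w) ν := integrable_levyKernel hd (by simp) w
  simp only [← levyKernel_second_difference]
  exact (hK _).sub (((hK _).add (hK _)).const_mul _)

end ContinuityPsi

/-! ### Separating the Gaussian part from the jump measure -/

section Uniqueness

variable {m : ℕ} {ρ ρ' : Measure (EuclideanSpace ℝ (Fin m))}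

/-- The measures may be infinite near 0. The density can be divided out where it is positive, and
countably many k suffice for these sets to cover the complement of 0. -/
lemma measure_eq_of_withDensity_one_sub_cos_eq (h0 : ρ.restrict {0}ᶜ = ρ)
    (h0' : ρ'.restrict {0}ᶜ = ρ')
    (h : ∀ k : EuclideanSpace ℝ (Fin m),
      ρ.withDensity (fun y => ENNReal.ofReal (1 - Real.cos (inner ℝ k y)))
        = ρ'.withDensity fun y => ENNReal.ofReal (1 - Real.cos (inner ℝ k y))) : ρ = ρ' := by
  have hrestr (k : EuclideanSpace ℝ (Fin m)) :
      ρ.restrict {y | Real.cos (inner ℝ k y) < 1}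
        = ρ'.restrict {y | Real.cos (inner ℝ k y) < 1} := by
    set g : EuclideanSpace ℝ (Fin m) → ℝ≥0∞ :=
      fun y => ENNReal.ofReal (1 - Real.cos (inner ℝ k y)) with hg
    have hgm : Measurable g := by fun_prop
    have hS : MeasurableSet {y : EuclideanSpace ℝ (Fin m) | Real.cos (inner ℝ k y) < 1} :=
      measurableSet_lt (by fun_prop) measurable_const
    have hgi : g * g⁻¹ = {y | Real.cos (inner ℝ k y) < 1}.indicator 1 := by
      funext y
      by_cases hy : Real.cos (inner ℝ k y) < 1
      · rw [Set.indicator_of_mem (by exact hy), Pi.mul_apply, Pi.inv_apply,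
          ENNReal.mul_inv_cancel (by simpa [hg] using hy) ENNReal.ofReal_ne_top, Pi.one_apply]
      · have : g y = 0 := by simpa [hg] using hy
        rw [Set.indicator_of_notMem (by exact hy), Pi.mul_apply, this, zero_mul]
    rw [← withDensity_indicator_one hS, ← withDensity_indicator_one hS, ← hgi,
      withDensity_mul _ hgm hgm.inv, withDensity_mul _ hgm hgm.inv, h k]
  have hU : ({0}ᶜ : Set (EuclideanSpace ℝ (Fin m)))
      = ⋃ p : Fin m × ℕ, {0}ᶜ ∩ {y | Real.cos
        (inner ℝ (EuclideanSpace.single p.1 (1 / ((p.2 : ℝ) + 1))) y) < 1} := by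
    rw [← Set.inter_iUnion, eq_comm, Set.inter_eq_left]
    intro y hy
    obtain ⟨j, hj⟩ : ∃ j, y j ≠ 0 := by
      by_contra! hcon
      exact hy (PiLp.ext hcon)
    -- With k = e_j / (n + 1) the number ⟨k, y⟩ is nonzero and smaller than 2π in absolute value, so
    -- its cosine is below 1.
    obtain ⟨n, hn⟩ := exists_nat_gt |y j|
    refine Set.mem_iUnion.2 ⟨(j, n), ?_⟩
    have hn0 : (0 : ℝ) < (n : ℝ) + 1 := by positivity
    have hlt : |1 / ((n : ℝ) + 1) * y j| < 2 * Real.pi := by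
      rw [abs_mul, abs_of_pos (by positivity), one_div, inv_mul_lt_iff₀ hn0]
      nlinarith [Real.pi_gt_three]
    simp only [Set.mem_ofPred_eq, EuclideanSpace.inner_single_left, conj_trivial]
    refine lt_of_le_of_ne (Real.cos_le_one _) fun hc => ?_
    rw [abs_lt] at hlt
    rw [Real.cos_eq_one_iff_of_lt_of_lt (by linarith) hlt.2] at hc
    exact mul_ne_zero (by positivity) hj hc
  rw [← h0, ← h0', hU, Measure.restrict_iUnion_congr]
  intro p
  rw [Set.inter_comm, ← Measure.restrict_restrict', ← Measure.restrict_restrict', h0, h0', hrestr]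
  · exact (measurableSet_singleton 0).compl
  · exact (measurableSet_singleton 0).compl

/-- The Gaussian part and the jump measure are determined by the second differences of the
exponent. -/
lemma quadratic_eq_and_measure_eq_of_second_difference_eq
    {q q' : EuclideanSpace ℝ (Fin m) → ℝ} (hq : ∀ k, 0 ≤ q k) (hq' : ∀ k, 0 ≤ q' k)
    (h0 : ρ.restrict {0}ᶜ = ρ) (h0' : ρ'.restrict {0}ᶜ = ρ')
    (hρ : ∀ k : EuclideanSpace ℝ (Fin m), Integrable (fun y => 1 - Real.cos (inner ℝ k y)) ρ)
    (hρ' : ∀ k : EuclideanSpace ℝ (Fin m), Integrable (fun y => 1 - Real.cos (inner ℝ k y)) ρ')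
    (h : ∀ v k : EuclideanSpace ℝ (Fin m),
      (q k : ℂ) + ∫ y, cexp (I * (inner ℝ v y : ℝ)) * (1 - Real.cos (inner ℝ k y) : ℝ) ∂ρ
      = q' k + ∫ y, cexp (I * (inner ℝ v y : ℝ)) * (1 - Real.cos (inner ℝ k y) : ℝ) ∂ρ') :
    q = q' ∧ ρ = ρ' := by
  have hg0 (k y : EuclideanSpace ℝ (Fin m)) : 0 ≤ 1 - Real.cos (inner ℝ k y) :=
    sub_nonneg.2 (Real.cos_le_one _)
  have hfin {σ : Measure (EuclideanSpace ℝ (Fin m))} {k : EuclideanSpace ℝ (Fin m)}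
      (hσ : Integrable (fun y => 1 - Real.cos (inner ℝ k y)) σ) :
      IsFiniteMeasure (σ.withDensity fun y => ENNReal.ofReal (1 - Real.cos (inner ℝ k y))) :=
    isFiniteMeasure_withDensity_ofReal hσ.2
  -- Each side of `h` is the characteristic function in v of a finite measure with a possible atom
  -- at 0.
  have hchar {σ : Measure (EuclideanSpace ℝ (Fin m))} {k : EuclideanSpace ℝ (Fin m)}
      (hσ : Integrable (fun y => 1 - Real.cos (inner ℝ k y)) σ) {r : ℝ} (hr : 0 ≤ r)
      (v : EuclideanSpace ℝ (Fin m)) :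
      charFun (ENNReal.ofReal r • Measure.dirac 0
        + σ.withDensity fun y => ENNReal.ofReal (1 - Real.cos (inner ℝ k y))) v
      = r + ∫ y, cexp (I * (inner ℝ v y : ℝ)) * (1 - Real.cos (inner ℝ k y) : ℝ) ∂σ := by
    have := hfin hσ
    have hb (τ : Measure (EuclideanSpace ℝ (Fin m))) [IsFiniteMeasure τ] :
        Integrable (fun y => cexp ((inner ℝ y v : ℝ) * I)) τ := by
      refine (integrable_const (1 : ℝ)).mono' (by fun_prop) (ae_of_all _ fun x => ?_)
      rw [Complex.norm_exp_ofReal_mul_I]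
    rw [charFun_apply, integral_add_measure ((hb _).smul_measure ENNReal.ofReal_ne_top) (hb _),
      integral_smul_measure, integral_dirac, integral_withDensity_eq_integral_toReal_smul
      (by fun_prop) (ae_of_all _ fun x => ENNReal.ofReal_lt_top)]
    congr 1
    · simp [ENNReal.toReal_ofReal hr]
    · refine integral_congr_ae (ae_of_all _ fun y => ?_)
      simp only [ENNReal.toReal_ofReal (hg0 k y), real_smul, real_inner_comm v]
      ring_nf
  have hmeas (k : EuclideanSpace ℝ (Fin m)) :
      ENNReal.ofReal (q k) • Measure.dirac 0
        + ρ.withDensity (fun y => ENNReal.ofReal (1 - Real.cos (inner ℝ k y)))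
      = ENNReal.ofReal (q' k) • Measure.dirac 0
        + ρ'.withDensity fun y => ENNReal.ofReal (1 - Real.cos (inner ℝ k y)) := by
    have := hfin (hρ k)
    have := hfin (hρ' k)
    have := (Measure.dirac (0 : EuclideanSpace ℝ (Fin m))).smul_finite
      (ENNReal.ofReal_ne_top (r := q k))
    have := (Measure.dirac (0 : EuclideanSpace ℝ (Fin m))).smul_finite
      (ENNReal.ofReal_ne_top (r := q' k))
    refine Measure.ext_of_charFun (funext fun v => ?_)
    rw [hchar (hρ k) (hq k), hchar (hρ' k) (hq' k), h]
  -- The density 1 - cos vanishes at 0, so the mass at the origin is exactly the quadratic term.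
  have hz {σ : Measure (EuclideanSpace ℝ (Fin m))} (k : EuclideanSpace ℝ (Fin m)) :
      (σ.withDensity fun y => ENNReal.ofReal (1 - Real.cos (inner ℝ k y))) {0} = 0 := by
    rw [withDensity_apply _ (measurableSet_singleton 0),
      setLIntegral_congr_fun (g := fun _ => 0) (measurableSet_singleton 0) fun y hy => ?_]
    · simp
    · rw [Set.mem_singleton_iff.1 hy]; simp
  have hqq (k) : q k = q' k := by
    have := congrArg (fun σ => σ {(0 : EuclideanSpace ℝ (Fin m))}) (hmeas k)
    simp only [Measure.add_apply, hz, Measure.smul_apply, smul_eq_mul, add_zero,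
      Measure.dirac_apply_of_mem (Set.mem_singleton _), mul_one] at this
    exact (ENNReal.ofReal_eq_ofReal_iff (hq k) (hq' k)).1 this
  refine ⟨funext hqq, measure_eq_of_withDensity_one_sub_cos_eq h0 h0' fun k => ?_⟩
  have hk := hmeas k
  rw [hqq k] at hk
  refine Measure.ext fun s _ => ?_
  have := congrArg (fun σ => σ s) hk
  simp only [Measure.add_apply] at this
  refine (ENNReal.add_right_inj ?_).1 this
  rw [Measure.smul_apply, smul_eq_mul]
  finiteness

end Uniqueness

/-! ### The exponent along the range of Uᵀ -/

/-- The transpose of `U`. -/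
def adjointU (m : ℕ) : EuclideanSpace ℝ (Fin m) →ₗ[ℝ] EuclideanSpace ℝ (Fin (m + 1)) :=
  LinearMap.adjoint (matrixU m).toEuclideanLin

section AdjointU

variable {m : ℕ} {μ ν ν' : Measure (EuclideanSpace ℝ (Fin (m + 1)))}
  {A A' : Matrix (Fin (m + 1)) (Fin (m + 1)) ℝ} {b b' : EuclideanSpace ℝ (Fin (m + 1))}

lemma inner_adjointU (v : EuclideanSpace ℝ (Fin m)) (x : EuclideanSpace ℝ (Fin (m + 1))) :
    inner ℝ (adjointU m v) x = inner ℝ v ((matrixU m).toEuclideanLin x) :=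
  LinearMap.adjoint_inner_left _ _ _

lemma sum_adjointU_mul (v : EuclideanSpace ℝ (Fin m)) (f : Fin (m + 1) → ℝ) :
    ∑ k, adjointU m v k * f k = ∑ j, v j * (f j.castSucc - f (Fin.last m)) := by
  have h := inner_adjointU v (WithLp.toLp 2 f)
  simp only [PiLp.inner_apply, matrixU_toEuclideanLin_apply, RCLike.inner_apply,
    conj_trivial] at h
  simpa only [mul_comm] using h

lemma sum_adjointU (v : EuclideanSpace ℝ (Fin m)) : ∑ k, adjointU m v k = 0 := by
  simpa using sum_adjointU_mul v fun _ => 1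

/-- The kernel of U is spanned by (1, …, 1), so the range of Uᵀ is its orthogonal complement. -/
lemma exists_adjointU_eq {w : EuclideanSpace ℝ (Fin (m + 1))} (hw : ∑ k, w k = 0) :
    ∃ v, adjointU m v = w := by
  refine ⟨WithLp.toLp 2 fun j => w j.castSucc, ext_inner_right ℝ fun x => ?_⟩
  rw [inner_adjointU]
  simp only [PiLp.inner_apply, matrixU_toEuclideanLin_apply, RCLike.inner_apply, conj_trivial]
  rw [Fin.sum_univ_castSucc] at hw ⊢
  rw [eq_neg_of_add_eq_zero_right hw]
  simp only [sub_mul, Finset.sum_sub_distrib, ← Finset.mul_sum]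
  ring

lemma inner_toEuclideanLin_eq_sum {d : ℕ} (A : Matrix (Fin d) (Fin d) ℝ)
    (u w : EuclideanSpace ℝ (Fin d)) :
    inner ℝ u (A.toEuclideanLin w) = ∑ k, ∑ l, u k * w l * A k l := by
  simp only [PiLp.inner_apply, Matrix.toLpLin_apply, Matrix.mulVec, dotProduct,
    RCLike.inner_apply, conj_trivial, Finset.sum_mul]
  refine Finset.sum_congr rfl fun k _ => Finset.sum_congr rfl fun l _ => ?_
  ring

/-- On vectors with zero sum, the quadratic form of `A` is given by the variogram. -/
lemma inner_toEuclideanLin_self_of_sum_eq_zero {d : ℕ} (A : Matrix (Fin d) (Fin d) ℝ)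
    {w : EuclideanSpace ℝ (Fin d)} (hw : ∑ k, w k = 0) :
    inner ℝ w (A.toEuclideanLin w) = -(1 / 2) * ∑ k, ∑ l, w k * w l * variogram A k l := by
  have h1 : ∑ k, ∑ l, w k * w l * A k k = 0 := by
    have h (k : Fin d) : ∑ l, w k * w l * A k k = (∑ l, w l) * (w k * A k k) := by
      rw [Finset.sum_mul]; exact Finset.sum_congr rfl fun l _ => by ring
    simp [h, hw]
  have h2 : ∑ k, ∑ l, w k * w l * A l l = 0 := by
    have h (k : Fin d) : ∑ l, w k * w l * A l l = w k * ∑ l, w l * A l l := by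
      rw [Finset.mul_sum]; exact Finset.sum_congr rfl fun l _ => by ring
    simp only [h, ← Finset.sum_mul, hw, zero_mul]
  have h3 : ∑ k, ∑ l, w k * w l * variogram A k l = ∑ k, ∑ l, w k * w l * A k k
      + ∑ k, ∑ l, w k * w l * A l l - 2 * ∑ k, ∑ l, w k * w l * A k l := by
    simp only [variogram, Finset.mul_sum, ← Finset.sum_add_distrib, ← Finset.sum_sub_distrib]
    exact Finset.sum_congr rfl fun k _ => Finset.sum_congr rfl fun l _ => by ring
  rw [inner_toEuclideanLin_eq_sum, h3, h1, h2]
  ring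

/-- For i = d the first term is the cross term of the exponent at e_d + iw; the second comes from
the diagonal entries in the exponents of the marginals. Their difference sees only the variogram. -/
lemma two_mul_toEuclideanLin_apply_sub_of_sum_eq_zero {d : ℕ} (A : Matrix (Fin d) (Fin d) ℝ)
    {w : EuclideanSpace ℝ (Fin d)} (hw : ∑ k, w k = 0) (i : Fin d) :
    2 * A.toEuclideanLin w i - ∑ k, w k * A k k = -∑ k, w k * variogram A i k := by
  have h1 : ∑ k, w k * variogram A i k
      = (∑ k, w k) * A i i + ∑ k, w k * A k k - 2 * ∑ k, A i k * w k := by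
    simp only [variogram, Finset.mul_sum, Finset.sum_mul, ← Finset.sum_add_distrib,
      ← Finset.sum_sub_distrib]
    exact Finset.sum_congr rfl fun k _ => by ring
  rw [h1, hw]
  simp only [Matrix.toLpLin_apply, Matrix.mulVec, dotProduct]
  ring

/-- The quadratic form at e_i - e_j, a vector with zero sum, equals γ_ij. -/
lemma variogram_eq_of_quadratic_eq (hA : A.IsHermitian) (hA' : A'.IsHermitian)
    (h : ∀ v, inner ℝ (adjointU m v) (A.toEuclideanLin (adjointU m v))
      = inner ℝ (adjointU m v) (A'.toEuclideanLin (adjointU m v))) (i j : Fin (m + 1)) :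
    variogram A i j = variogram A' i j := by
  set w : EuclideanSpace ℝ (Fin (m + 1)) := EuclideanSpace.single i 1 - EuclideanSpace.single j 1
    with hw
  obtain ⟨v, hv⟩ := exists_adjointU_eq (w := w) (by simp [hw])
  have key (B : Matrix (Fin (m + 1)) (Fin (m + 1)) ℝ) (hB : B.IsHermitian) :
      inner ℝ w (B.toEuclideanLin w) = variogram B i j := by
    have hs : B j i = B i j := by simpa using hB.apply i j
    rw [hw, map_sub, inner_sub_left, inner_sub_right, inner_sub_right, inner_single_one,
      inner_single_one, inner_single_one, inner_single_one, toEuclideanLin_single_apply,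
      toEuclideanLin_single_apply, toEuclideanLin_single_apply, toEuclideanLin_single_apply, hs,
      variogram]
    ring
  have := h v
  rwa [hv, key A hA, key A' hA'] at this

lemma charFun_map_tiltLast (v : EuclideanSpace ℝ (Fin m)) :
    charFun ((tiltLast μ).map fun x => (matrixU m).toEuclideanLin x) v
      = ∫ x, cexp ((inner ℝ (EuclideanSpace.single (Fin.last m) 1) x : ℝ)
          + I * (inner ℝ (adjointU m v) x : ℝ)) ∂μ := by
  rw [charFun_apply, integral_map (by fun_prop) (by fun_prop), integral_tiltLast]
  refine integral_congr_ae (ae_of_all _ fun x => ?_)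
  simp only [inner_single_one, inner_adjointU, Complex.exp_add, real_smul, ofReal_exp,
    real_inner_comm v, mul_comm I]

lemma restrict_tiltedImage : (tiltedImage ν).restrict {0}ᶜ = tiltedImage ν := by
  rw [tiltedImage, Measure.restrict_restrict (measurableSet_singleton 0).compl, Set.inter_self]

/-- Jumps in the kernel of U, possibly of infinite total mass, are sent to 0 and discarded by the
restriction; `h0` makes this harmless. -/
lemma integral_tiltedImage {F : Type*} [NormedAddCommGroup F] [NormedSpace ℝ F]
    [MeasurableSpace F] [BorelSpace F] [SecondCountableTopology F]
    {g : EuclideanSpace ℝ (Fin m) → F} (hg : Measurable g) (h0 : g 0 = 0) :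
    ∫ y, g y ∂tiltedImage ν
      = ∫ x, Real.exp (x (Fin.last m)) • g ((matrixU m).toEuclideanLin x) ∂ν := by
  rw [tiltedImage, setIntegral_eq_integral_of_forall_compl_eq_zero,
    integral_map (by fun_prop) hg.aestronglyMeasurable, integral_tiltLast]
  intro y hy
  rw [Set.notMem_compl_iff.1 hy, h0]

lemma integrable_tiltedImage {F : Type*} [NormedAddCommGroup F] [NormedSpace ℝ F]
    [MeasurableSpace F] [BorelSpace F] [SecondCountableTopology F]
    {g : EuclideanSpace ℝ (Fin m) → F} (hg : Measurable g)
    (h : Integrable (fun x => Real.exp (x (Fin.last m)) • g ((matrixU m).toEuclideanLin x)) ν) :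
    Integrable g (tiltedImage ν) := by
  refine Integrable.restrict ?_
  rw [integrable_map_measure hg.aestronglyMeasurable (by fun_prop)]
  exact integrable_tiltLast_iff.2 h

lemma integrable_one_sub_cos_tiltedImage
    (hd : Integrable (levyDom (EuclideanSpace.single (Fin.last m) 1)) ν)
    (k : EuclideanSpace ℝ (Fin m)) :
    Integrable (fun y => 1 - Real.cos (inner ℝ k y)) (tiltedImage ν) := by
  refine integrable_tiltedImage (by fun_prop) ?_
  refine (integrable_exp_mul_one_sub_cos hd 0 (adjointU m k)).re.congr (ae_of_all _ fun x => ?_)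
  simp only [inner_single_one, inner_zero_left, ofReal_zero, mul_zero, add_zero, ← ofReal_exp,
    ← ofReal_mul, inner_adjointU]
  rfl

lemma levyPsi_adjointU_second_difference (hA : A.PosSemidef)
    (hd : Integrable (levyDom (EuclideanSpace.single (Fin.last m) 1)) ν)
    (v k : EuclideanSpace ℝ (Fin m)) :
    (1 / 2 * inner ℝ (adjointU m k) (A.toEuclideanLin (adjointU m k)) : ℝ)
      + ∫ y, cexp (I * (inner ℝ v y : ℝ)) * (1 - Real.cos (inner ℝ k y) : ℝ) ∂tiltedImage ν
    = levyPsi A ν b 1 (EuclideanSpace.single (Fin.last m) 1) (adjointU m v)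
      - 1 / 2 * (levyPsi A ν b 1 (EuclideanSpace.single (Fin.last m) 1) (adjointU m (v + k))
        + levyPsi A ν b 1 (EuclideanSpace.single (Fin.last m) 1) (adjointU m (v - k))) := by
  rw [map_add, map_sub, levyPsi_second_difference hA hd, integral_tiltedImage (by fun_prop)
    (by simp)]
  congr 1
  refine integral_congr_ae (ae_of_all _ fun x => ?_)
  simp only [inner_single_one, inner_adjointU, Complex.exp_add, real_smul, ofReal_exp]
  ring

/-- The exponent of the tilted law of `U ξ` determines the variogram and the tilted jump
measure. -/
theorem variogram_eq_and_tiltedImage_eq (hA : A.PosSemidef) (hA' : A'.PosSemidef)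
    (hd : Integrable (levyDom (EuclideanSpace.single (Fin.last m) 1)) ν)
    (hd' : Integrable (levyDom (EuclideanSpace.single (Fin.last m) 1)) ν')
    (h : ∀ v, levyPsi A ν b 1 (EuclideanSpace.single (Fin.last m) 1) (adjointU m v)
      = levyPsi A' ν' b' 1 (EuclideanSpace.single (Fin.last m) 1) (adjointU m v)) :
    (∀ i j, variogram A i j = variogram A' i j) ∧ tiltedImage ν = tiltedImage ν' := by
  have key := quadratic_eq_and_measure_eq_of_second_difference_eq
    (ρ := tiltedImage ν) (ρ' := tiltedImage ν')
    (q := fun k => 1 / 2 * inner ℝ (adjointU m k) (A.toEuclideanLin (adjointU m k)))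
    (q' := fun k => 1 / 2 * inner ℝ (adjointU m k) (A'.toEuclideanLin (adjointU m k)))
    (fun k => mul_nonneg (by norm_num) (inner_toEuclideanLin_self_nonneg hA _))
    (fun k => mul_nonneg (by norm_num) (inner_toEuclideanLin_self_nonneg hA' _))
    restrict_tiltedImage restrict_tiltedImage (integrable_one_sub_cos_tiltedImage hd)
    (integrable_one_sub_cos_tiltedImage hd') fun v k => by
      rw [levyPsi_adjointU_second_difference (b := b) hA hd,
        levyPsi_adjointU_second_difference (b := b') hA' hd', h, h, h]
  refine ⟨variogram_eq_of_quadratic_eq hA.1 hA'.1 fun v => ?_, key.2⟩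
  exact mul_left_cancel₀ (by norm_num) (congrFun key.1 v)

/-- Subtracting the compensated exponentials of the coordinates replaces the truncation by the
compensator e^{y_j} - 1. Because the weights sum to zero, the constants cancel and what remains is
e^{x_d} times a function of Ux, hence an integrand for the tilted image. -/
lemma levyKernel_sub_sum (v : EuclideanSpace ℝ (Fin m)) (x : EuclideanSpace ℝ (Fin (m + 1))) :
    levyKernel 1 (EuclideanSpace.single (Fin.last m) 1) (adjointU m v) x
        - (expCompensated (Fin.last m) x : ℝ)
        - I * (∑ k, adjointU m v k * expCompensated k x : ℝ)
      = Real.exp (x (Fin.last m)) • (cexp (I * (inner ℝ v ((matrixU m).toEuclideanLin x) : ℝ)) - 1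
          - I * (∑ j, v j * (Real.exp ((matrixU m).toEuclideanLin x j) - 1) : ℝ)) := by
  have h1 : ∑ k, adjointU m v k * expCompensated k x
      = Real.exp (x (Fin.last m)) * ∑ j, v j * (Real.exp ((matrixU m).toEuclideanLin x j) - 1)
        - inner ℝ (adjointU m v) x * levyTrunc x := by
    have h2 : ∑ k, adjointU m v k * expCompensated k x
        = ∑ k, adjointU m v k * (Real.exp (x k)) - ∑ k, adjointU m v k
          - (∑ k, adjointU m v k * x k) * levyTrunc x := by
      simp only [expCompensated, Finset.sum_mul, ← Finset.sum_sub_distrib]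
      exact Finset.sum_congr rfl fun k _ => by ring
    have h3 : inner ℝ (adjointU m v) x = ∑ k, adjointU m v k * x k := by
      simp [PiLp.inner_apply, mul_comm]
    rw [h2, sum_adjointU, sum_adjointU_mul, h3, sub_zero, Finset.mul_sum]
    congr 1
    refine Finset.sum_congr rfl fun j _ => ?_
    rw [matrixU_toEuclideanLin_apply, Real.exp_sub]
    field_simp
  rw [h1, levyKernel, expCompensated, inner_single_one, one_mul, Complex.exp_add,
    ← inner_adjointU, real_smul]
  push_cast
  ring

/-- The exponent of the tilted law of `U ξ` in terms of the exponents of the marginals, the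
variogram and the tilted jump measure. -/
lemma levyPsi_adjointU_eq
    (hd : ∀ k, Integrable (levyDom (EuclideanSpace.single k 1)) ν) (v : EuclideanSpace ℝ (Fin m)) :
    levyPsi A ν b 1 (EuclideanSpace.single (Fin.last m) 1) (adjointU m v)
      = (levyExponent A ν b (Fin.last m) : ℝ)
        + I * (∑ k, adjointU m v k * levyExponent A ν b k : ℝ)
        + 1 / 2 * (1 / 2 * (∑ k, ∑ l, adjointU m v k * adjointU m v l * variogram A k l : ℝ)
          - I * (∑ k, adjointU m v k * variogram A (Fin.last m) k : ℝ))
        + ∫ y, (cexp (I * (inner ℝ v y : ℝ)) - 1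
          - I * (∑ j, v j * (Real.exp (y j) - 1) : ℝ)) ∂tiltedImage ν := by
  have hK := integrable_levyKernel (hd (Fin.last m)) (z := 1) (by simp) (adjointU m v)
  have hE (k) : Integrable (expCompensated k) ν := integrable_expCompensated k (hd k)
  have hE' (k) : Integrable (fun x => ((expCompensated k x : ℝ) : ℂ)) ν := (hE k).ofReal
  have hS : Integrable (fun x => ∑ k, adjointU m v k * expCompensated k x) ν :=
    integrable_finsetSum _ fun k _ => (hE k).const_mul _
  have hS' : Integrable (fun x => I * ((∑ k, adjointU m v k * expCompensated k x : ℝ) : ℂ)) ν :=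
    (hS.ofReal (𝕜 := ℂ)).const_mul I
  have hint : ∫ y, (cexp (I * (inner ℝ v y : ℝ)) - 1
          - I * (∑ j, v j * (Real.exp (y j) - 1) : ℝ)) ∂tiltedImage ν
      = ∫ x, levyKernel 1 (EuclideanSpace.single (Fin.last m) 1) (adjointU m v) x ∂ν
        - (∫ x, expCompensated (Fin.last m) x ∂ν : ℝ)
        - I * (∑ k, adjointU m v k * ∫ x, expCompensated k x ∂ν : ℝ) := by
    have hsum : ∑ k, adjointU m v k * ∫ x, expCompensated k x ∂ν
        = ∫ x, ∑ k, adjointU m v k * expCompensated k x ∂ν := by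
      rw [integral_finsetSum _ fun k _ => (hE k).const_mul _]
      simp only [integral_const_mul]
    rw [integral_tiltedImage (by fun_prop) (by simp), hsum, ← integral_complex_ofReal,
      ← integral_complex_ofReal, ← integral_const_mul, ← integral_sub hK (hE' _)]
    have h := integral_sub (hK.sub (hE' (Fin.last m))) hS'
    simp only [Pi.sub_apply] at h
    rw [← h]
    simp only [levyKernel_sub_sum]
  have hq := inner_toEuclideanLin_self_of_sum_eq_zero A (sum_adjointU v)
  have hl := two_mul_toEuclideanLin_apply_sub_of_sum_eq_zero A (sum_adjointU v) (Fin.last m)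
  have hb : inner ℝ b (adjointU m v) = ∑ k, adjointU m v k * b k := by
    simp [PiLp.inner_apply]
  have hL : ∑ k, adjointU m v k * levyExponent A ν b k = ∑ k, adjointU m v k * b k
      + 1 / 2 * ∑ k, adjointU m v k * A k k
      + ∑ k, adjointU m v k * ∫ x, expCompensated k x ∂ν := by
    simp only [levyExponent, Finset.mul_sum, ← Finset.sum_add_distrib]
    exact Finset.sum_congr rfl fun k _ => by ring
  have hl' : ∑ k, adjointU m v k * variogram A (Fin.last m) k
      = ∑ k, adjointU m v k * A k k - 2 * A.toEuclideanLin (adjointU m v) (Fin.last m) := by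
    linarith
  have hq' : ∑ k, ∑ l, adjointU m v k * adjointU m v l * variogram A k l
      = -2 * inner ℝ (adjointU m v) (A.toEuclideanLin (adjointU m v)) := by linarith
  rw [hint, levyPsi, hL, hl', hq', levyExponent, inner_single_one, inner_single_one,
    toEuclideanLin_single_apply, hb, real_inner_comm, inner_single_one]
  push_cast
  ring

end AdjointU

/-! ### Zonoid equivalence in terms of the triplets -/

section Zonoid

lemma zonoidEquivalent_expVec_iff {d : ℕ} {Ω Ω' : Type*} [MeasurableSpace Ω] [MeasurableSpace Ω']
    {P : Measure Ω} {P' : Measure Ω'} {ξ : Ω → EuclideanSpace ℝ (Fin d)}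
    {ξ' : Ω' → EuclideanSpace ℝ (Fin d)} (hξ : AEMeasurable ξ P) (hξ' : AEMeasurable ξ' P')
    (hint : Integrable (fun ω => expVec (ξ ω)) P)
    (hint' : Integrable (fun ω => expVec (ξ' ω)) P') :
    ZonoidEquivalent (fun ω => expVec (ξ ω)) P (fun ω => expVec (ξ' ω)) P' ↔
      ∀ u, ∫ x, |inner ℝ u (expVec x)| ∂P.map ξ = ∫ x, |inner ℝ u (expVec x)| ∂P'.map ξ' := by
  have h (u) : ∫ x, |inner ℝ u (expVec x)| ∂P.map ξ = ∫ ω, |inner ℝ u (expVec (ξ ω))| ∂P :=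
    integral_map hξ (by fun_prop)
  have h' (u) : ∫ x, |inner ℝ u (expVec x)| ∂P'.map ξ' = ∫ ω, |inner ℝ u (expVec (ξ' ω))| ∂P' :=
    integral_map hξ' (by fun_prop)
  simp only [h, h']
  exact ⟨fun H => H.integral_abs_inner_eq, fun H => ⟨hint, hint', H⟩⟩

variable {m : ℕ} {μ μ' ν ν' : Measure (EuclideanSpace ℝ (Fin (m + 1)))}
  {A A' : Matrix (Fin (m + 1)) (Fin (m + 1)) ℝ} {b b' : EuclideanSpace ℝ (Fin (m + 1))}

lemma integral_exp_eq_of_integral_abs_inner_eq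
    (H : ∀ u, ∫ x, |inner ℝ u (expVec x)| ∂μ = ∫ x, |inner ℝ u (expVec x)| ∂μ')
    (i : Fin (m + 1)) : ∫ x, Real.exp (x i) ∂μ = ∫ x, Real.exp (x i) ∂μ' := by
  have := H (EuclideanSpace.single i 1)
  simpa only [inner_single_one, expVec_apply, abs_of_pos (Real.exp_pos _)] using this

theorem integral_abs_inner_expVec_eq_iff_of_levyTriplet [IsProbabilityMeasure μ]
    [IsProbabilityMeasure μ'] (h : HasLevyTriplet μ A ν b) (h' : HasLevyTriplet μ' A' ν' b')
    (hμ : Integrable expVec μ) (hμ' : Integrable expVec μ') :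
    (∀ u, ∫ x, |inner ℝ u (expVec x)| ∂μ = ∫ x, |inner ℝ u (expVec x)| ∂μ') ↔
      (∀ i j, variogram A i j = variogram A' i j) ∧ tiltedImage ν = tiltedImage ν' ∧
        ∀ i, ∫ x, Real.exp (x i) ∂μ = ∫ x, Real.exp (x i) ∂μ' := by
  have hd (i) := h.integrable_levyDom_single i (integrable_exp_apply hμ i)
  have hd' (i) := h'.integrable_levyDom_single i (integrable_exp_apply hμ' i)
  have hL (i) := h.integral_exp_apply i (integrable_exp_apply hμ i)
  have hL' (i) := h'.integral_exp_apply i (integrable_exp_apply hμ' i)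
  have := isFiniteMeasure_tiltLast hμ
  have := isFiniteMeasure_tiltLast hμ'
  have hchar (v) : charFun ((tiltLast μ).map fun x => (matrixU m).toEuclideanLin x) v
      = cexp (levyPsi A ν b 1 (EuclideanSpace.single (Fin.last m) 1) (adjointU m v)) := by
    rw [charFun_map_tiltLast, h.integral_exp_eq]
    simpa only [inner_single_one] using integrable_exp_apply hμ (Fin.last m)
  have hchar' (v) : charFun ((tiltLast μ').map fun x => (matrixU m).toEuclideanLin x) v
      = cexp (levyPsi A' ν' b' 1 (EuclideanSpace.single (Fin.last m) 1) (adjointU m v)) := by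
    rw [charFun_map_tiltLast, h'.integral_exp_eq]
    simpa only [inner_single_one] using integrable_exp_apply hμ' (Fin.last m)
  have hadj : Continuous fun v => adjointU m v := LinearMap.continuous_of_finiteDimensional _
  constructor
  · intro H
    have hmean := integral_exp_eq_of_integral_abs_inner_eq H
    have hexp (v) : cexp (levyPsi A ν b 1 (EuclideanSpace.single (Fin.last m) 1) (adjointU m v))
        = cexp (levyPsi A' ν' b' 1 (EuclideanSpace.single (Fin.last m) 1) (adjointU m v)) := by
      rw [← hchar, ← hchar', (integral_abs_inner_expVec_eq_iff hμ hμ').1 H]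
    -- At v = 0 both exponents are real, the logarithms of the means of e^{ξ_d} and e^{ξ*_d}, which
    -- fixes the branch.
    have hΨ := eq_of_exp_eq_of_continuous (x₀ := 0)
      ((continuous_levyPsi (A := A) (b := b) (hd (Fin.last m))).comp hadj)
      ((continuous_levyPsi (A := A') (b := b') (hd' (Fin.last m))).comp hadj) hexp (by
        have h0 := hmean (Fin.last m)
        rw [hL, hL'] at h0
        simp only [Function.comp_apply, map_zero, levyPsi_single, Real.exp_injective h0])
    have key := variogram_eq_and_tiltedImage_eq h.posSemidef h'.posSemidef (hd _) (hd' _) hΨ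
    exact ⟨key.1, key.2, hmean⟩
  · rintro ⟨hγ, hρ, hmean⟩
    refine (integral_abs_inner_expVec_eq_iff hμ hμ').2 (Measure.ext_of_charFun (funext fun v => ?_))
    have hLL (i) : levyExponent A ν b i = levyExponent A' ν' b' i :=
      Real.exp_injective (by rw [← hL, ← hL', hmean])
    rw [hchar, hchar', levyPsi_adjointU_eq hd, levyPsi_adjointU_eq hd', hρ]
    simp only [hγ, hLL]

end Zonoid

end

theorem mainTheorem10 {m : ℕ} {Ω Ω' : Type*} [MeasurableSpace Ω] [MeasurableSpace Ω']
    (P : Measure Ω) [IsProbabilityMeasure P] (P' : Measure Ω') [IsProbabilityMeasure P']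
    (ξ : Ω → EuclideanSpace ℝ (Fin (m + 1))) (ξ' : Ω' → EuclideanSpace ℝ (Fin (m + 1)))
    (hξ : AEMeasurable ξ P) (hξ' : AEMeasurable ξ' P')
    (hint : Integrable (fun ω => expVec (ξ ω)) P)
    (hint' : Integrable (fun ω => expVec (ξ' ω)) P')
    (A A' : Matrix (Fin (m + 1)) (Fin (m + 1)) ℝ)
    (ν ν' : Measure (EuclideanSpace ℝ (Fin (m + 1))))
    (b b' : EuclideanSpace ℝ (Fin (m + 1)))
    (htriplet : HasLevyTriplet (P.map ξ) A ν b)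
    (htriplet' : HasLevyTriplet (P'.map ξ') A' ν' b') :
    -- case `d = m + 1 ≥ 2`
    (2 ≤ m + 1 →
      (ZonoidEquivalent (fun ω => expVec (ξ ω)) P (fun ω => expVec (ξ' ω)) P' ↔
        (∀ i j, variogram A i j = variogram A' i j) ∧
        tiltedImage ν = tiltedImage ν' ∧
        (∀ i, ∫ ω, Real.exp (ξ ω i) ∂P = ∫ ω, Real.exp (ξ' ω i) ∂P'))) ∧
    -- case `d = m + 1 = 1`
    (m + 1 = 1 →
      (ZonoidEquivalent (fun ω => expVec (ξ ω)) P (fun ω => expVec (ξ' ω)) P' ↔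
        ∀ i, ∫ ω, Real.exp (ξ ω i) ∂P = ∫ ω, Real.exp (ξ' ω i) ∂P')) ∧
    -- the equality of means in terms of the triplets
    (∀ i, Integrable (expCompensated i) ν ∧ Integrable (expCompensated i) ν' ∧
      (∫ ω, Real.exp (ξ ω i) ∂P = ∫ ω, Real.exp (ξ' ω i) ∂P' ↔
        levyExponent A ν b i = levyExponent A' ν' b' i)) := by
  have : IsProbabilityMeasure (P.map ξ) := Measure.isProbabilityMeasure_map hξ
  have : IsProbabilityMeasure (P'.map ξ') := Measure.isProbabilityMeasure_map hξ'
  have hμ : Integrable expVec (P.map ξ) :=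
    (integrable_map_measure measurable_expVec.aestronglyMeasurable hξ).2 hint
  have hμ' : Integrable expVec (P'.map ξ') :=
    (integrable_map_measure measurable_expVec.aestronglyMeasurable hξ').2 hint'
  have hE (i) : ∫ ω, Real.exp (ξ ω i) ∂P = ∫ x, Real.exp (x i) ∂P.map ξ :=
    (integral_map (f := fun x => Real.exp (x i)) hξ (by fun_prop)).symm
  have hE' (i) : ∫ ω, Real.exp (ξ' ω i) ∂P' = ∫ x, Real.exp (x i) ∂P'.map ξ' :=
    (integral_map (f := fun x => Real.exp (x i)) hξ' (by fun_prop)).symm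
  simp only [zonoidEquivalent_expVec_iff hξ hξ' hint hint', hE, hE']
  refine ⟨fun _ => integral_abs_inner_expVec_eq_iff_of_levyTriplet htriplet htriplet' hμ hμ',
    fun hm => ⟨integral_exp_eq_of_integral_abs_inner_eq, fun H u => ?_⟩, fun i => ⟨?_, ?_, ?_⟩⟩
  -- On the line |u e^x| = |u| e^x, so the means determine all the integrals.
  · obtain rfl : m = 0 := by omega
    have h1 (x : EuclideanSpace ℝ (Fin (0 + 1))) :
        |inner ℝ u (expVec x)| = |u 0| * Real.exp (x 0) := by
      simp [PiLp.inner_apply, expVec_apply, abs_mul, mul_comm]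
    simp only [h1, integral_const_mul, H]
  · exact integrable_expCompensated i
      (htriplet.integrable_levyDom_single i (integrable_exp_apply hμ i))
  · exact integrable_expCompensated i
      (htriplet'.integrable_levyDom_single i (integrable_exp_apply hμ' i))
  · rw [htriplet.integral_exp_apply i (integrable_exp_apply hμ i),
      htriplet'.integral_exp_apply i (integrable_exp_apply hμ' i), Real.exp_injective.eq_iff]
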